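/- Let $n\ge 2$ and let $z=(z_{ij})_{1\le i,j\le n}$ be a matrix of indeterminates. Let $I_n\subseteq\mathbb R[z]$ be the ideal generated by all $2\times 2$ minors $z_{ij}z_{kl}-z_{il}z_{kj}$ of $z$, let $J\subseteq\mathbb R[z]$ be the ideal generated by the trace $\sum_{i=1}^n z_{ii}$, and let $J_n=I_n+J$. Let $V_{\mathbb C}(J_n)\subseteq\mathbb P^{n^2-1}$ be the complex projective zero locus of $J_n$, i.e. the projective variety of all complex $n\times n$ matrices of rank one and trace zero, and let $H=V_{\mathbb C}\left(\sum_{i=1}^n z_{ii}\right)\subseteq\mathbb P^{n^2-1}$ be the hyperplane of trace-zero matrices. Then: (a) $V_{\mathbb C}(J_n)$ is smooth, that is, at each of its points the projective Zariski tangent space has dimension equal to the local dimension of the variety; (b) $V_{\mathbb C}(J_n)$ is a nondegenerate subvariety of $H$, that is, it is contained in $H$ but in no hyperplane of $H$; (c) $\dim V_{\mathbb C}(J_n)=2n-3$; (d) the codimension $\dim H-\dim V_{\mathbb C}(J_n)$ of $V_{\mathbb C}(J_n)$ in $H$ equals $(n-1)^2$; (e) the degree of $V_{\mathbb C}(J_n)$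 (defined as $r!$ times the leading coefficient of its Hilbert polynomial, where $r$ is its dimension) equals $\binom{2n-2}{n-1}$. -/

import Mathlib

noncomputable section

/-- Complex projective space with homogeneous coordinates indexed by `σ`. -/
abbrev PSpace (σ : Type) : Type := Projectivization ℂ (σ → ℂ)

section ProjectiveGeometry

variable {σ : Type}

/-- The projective zero locus of a set `T` of polynomials: the common zeros of the homogeneous
elements of `T`. (For a homogeneous polynomial, vanishing at a point does not depend on the
representative.) -/
def projZeroLocus (T : Set (MvPolynomial σ ℂ)) : Set (PSpace σ) :=
  {P | ∀ f ∈ T, (∃ d : ℕ, f.IsHomogeneous d) → MvPolynomial.eval P.rep f = 0}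

theorem projZeroLocus_singleton_one :
    projZeroLocus ({1} : Set (MvPolynomial σ ℂ)) = ∅ := by
  ext P
  simp only [projZeroLocus, Set.mem_singleton_iff, forall_eq, Set.mem_ofPred_eq,
    Set.mem_empty_iff_false, iff_false, map_one]
  exact fun h => one_ne_zero (h ⟨0, MvPolynomial.isHomogeneous_one σ ℂ⟩)

theorem projZeroLocus_sUnion (A : Set (Set (MvPolynomial σ ℂ))) :
    projZeroLocus (⋃₀ A) = ⋂ T ∈ A, projZeroLocus T := by
  ext P
  simp only [projZeroLocus, Set.mem_sUnion, Set.mem_ofPred_eq, Set.mem_iInter]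
  exact ⟨fun h T hT f hf hd => h f ⟨T, hT, hf⟩ hd, fun h f ⟨T, hT, hf⟩ hd => h T hT f hf hd⟩

theorem projZeroLocus_union (S T : Set (MvPolynomial σ ℂ)) :
    projZeroLocus S ∪ projZeroLocus T =
      projZeroLocus {h | ∃ f ∈ S, ∃ g ∈ T, (∃ d : ℕ, f.IsHomogeneous d) ∧
        (∃ e : ℕ, g.IsHomogeneous e) ∧ h = f * g} := by
  ext P
  constructor
  · rintro (hP | hP)
    · rintro _ ⟨f, hf, g, hg, hd, he, rfl⟩ -
      rw [map_mul, hP f hf hd, zero_mul]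
    · rintro _ ⟨f, hf, g, hg, hd, he, rfl⟩ -
      rw [map_mul, hP g hg he, mul_zero]
  · intro h
    by_contra hP
    simp only [projZeroLocus, Set.mem_union, Set.mem_ofPred_eq, not_or, not_forall] at hP
    obtain ⟨⟨f, hf, ⟨d, hd⟩, hf0⟩, ⟨g, hg, ⟨e, he⟩, hg0⟩⟩ := hP
    have h0 := h (f * g) ⟨f, hf, g, hg, ⟨d, hd⟩, ⟨e, he⟩, rfl⟩ ⟨d + e, hd.mul he⟩
    rw [map_mul] at h0
    exact (mul_ne_zero hf0 hg0) h0

/-- The Zariski topology on projective space: the closed sets are the projective zero loci. -/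
instance zariskiTopology : TopologicalSpace (PSpace σ) :=
  TopologicalSpace.ofClosed (Set.range projZeroLocus)
    ⟨{1}, projZeroLocus_singleton_one⟩
    (by
      intro A hA
      refine ⟨⋃₀ {T | projZeroLocus T ∈ A}, ?_⟩
      rw [projZeroLocus_sUnion]
      ext P
      simp only [Set.mem_iInter, Set.mem_ofPred_eq, Set.mem_sInter]
      constructor
      · intro h Z hZ
        obtain ⟨T, rfl⟩ := hA hZ
        exact h T hZ
      · exact fun h T hT => h _ hT)
    (by
      rintro _ ⟨S, rfl⟩ _ ⟨T, rfl⟩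
      exact ⟨_, (projZeroLocus_union S T).symm⟩)

/-- The ideal of all polynomials vanishing on (the punctured affine cone over) `V`. -/
def vanishingIdealProj (V : Set (PSpace σ)) : Ideal (MvPolynomial σ ℂ) where
  carrier := {f | ∀ (v : σ → ℂ) (hv : v ≠ 0), Projectivization.mk ℂ v hv ∈ V →
    MvPolynomial.eval v f = 0}
  zero_mem' := fun _ _ _ => map_zero _
  add_mem' := fun {f g} hf hg v hv hV => by rw [map_add, hf v hv hV, hg v hv hV, add_zero]
  smul_mem' := fun c f hf v hv hV => by rw [smul_eq_mul, map_mul, hf v hv hV, mul_zero]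

/-- The dimension of a subset of projective space: the Krull dimension of the Zariski subspace
topology. -/
def projDim (V : Set (PSpace σ)) : WithBot ℕ∞ := topologicalKrullDim V

/-- The local dimension of `V` at `P`: the least dimension of `V ∩ U` over the Zariski open
neighbourhoods `U` of `P`. -/
def localProjDim (V : Set (PSpace σ)) (P : PSpace σ) : WithBot ℕ∞ :=
  ⨅ U : {U : Set (PSpace σ) // IsOpen U ∧ P ∈ U}, projDim (V ∩ U.1)

/-- The linear subspace of `ℂ^σ` whose projectivization is the projective (Zariski) tangent space
of `V` at `P`: the common kernel of the differentials at `P` of all polynomials vanishing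
on `V`. -/
def affineTangentSpace [Fintype σ] (V : Set (PSpace σ)) (P : PSpace σ) : Submodule ℂ (σ → ℂ) where
  carrier := {w | ∀ f ∈ vanishingIdealProj V,
    ∑ i, MvPolynomial.eval P.rep (MvPolynomial.pderiv i f) * w i = 0}
  zero_mem' := fun f _ => by simp
  add_mem' := fun {w w'} hw hw' f hf => by
    simp only [Pi.add_apply, mul_add, Finset.sum_add_distrib, hw f hf, hw' f hf, add_zero]
  smul_mem' := fun c w hw f hf => by
    have h := hw f hf
    simp only [Pi.smul_apply, smul_eq_mul, mul_left_comm _ c, ← Finset.mul_sum, h, mul_zero]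

/-- `V` is smooth: at each of its points the projective tangent space, of dimension
`finrank (affineTangentSpace V P) - 1`, has the dimension of `V` at that point. -/
def IsSmoothProj [Fintype σ] (V : Set (PSpace σ)) : Prop :=
  ∀ P ∈ V, (Module.finrank ℂ (affineTangentSpace V P) : WithBot ℕ∞) = localProjDim V P + 1

/-- `V` is nondegenerate in the linear subspace `H`: it lies in `H` and in no hyperplane of `H`,
i.e. in no zero locus of a linear form that does not vanish identically on `H`. -/
def IsNondegenerateIn (V H : Set (PSpace σ)) : Prop :=
  V ⊆ H ∧ ∀ l : (σ → ℂ) →ₗ[ℂ] ℂ, ¬ (∀ P ∈ H, l P.rep = 0) → ¬ (∀ P ∈ V, l P.rep = 0)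

/-- `V` is contained in `W` with codimension `c = dim W - dim V`. -/
def HasCodimIn (V W : Set (PSpace σ)) (c : ℕ) : Prop :=
  V ⊆ W ∧ ∃ a b : ℕ, projDim V = a ∧ projDim W = b ∧ a + c = b

/-- The Hilbert function of `V`: the dimension of the degree `d` part of the homogeneous
coordinate ring of `V`. -/
def hilbertFunction (V : Set (PSpace σ)) (d : ℕ) : ℕ :=
  Module.finrank ℂ ((MvPolynomial.homogeneousSubmodule σ ℂ d).map
    (Ideal.Quotient.mkₐ ℂ (vanishingIdealProj V)).toLinearMap)

/-- `p` is the (unique) Hilbert polynomial of `V`. -/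
def IsHilbertPolynomial (V : Set (PSpace σ)) (p : Polynomial ℚ) : Prop :=
  ∃ N : ℕ, ∀ d : ℕ, N ≤ d → p.eval (d : ℚ) = hilbertFunction V d

/-- `V` has degree `δ`: its Hilbert polynomial has degree `r = dim V` and leading coefficient
`δ / r!`. -/
def HasProjDegree (V : Set (PSpace σ)) (δ : ℕ) : Prop :=
  ∃ (r : ℕ) (p : Polynomial ℚ), projDim V = r ∧ IsHilbertPolynomial V p ∧ p.natDegree = r ∧
    (r.factorial : ℚ) * p.leadingCoeff = δ

end ProjectiveGeometry

/-- The ideal of `ℝ[z_ij]` generated by the 2 × 2 minors of the generic matrix `(z_ij)`. -/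
def minorsIdeal (n : ℕ) : Ideal (MvPolynomial (Fin n × Fin n) ℝ) :=
  Ideal.span {f | ∃ i j k l : Fin n, f = MvPolynomial.X (i, j) * MvPolynomial.X (k, l) -
    MvPolynomial.X (i, l) * MvPolynomial.X (k, j)}

/-- The ideal of `ℝ[z_ij]` generated by the trace of the generic matrix `(z_ij)`. -/
def traceIdeal (n : ℕ) : Ideal (MvPolynomial (Fin n × Fin n) ℝ) :=
  Ideal.span {∑ i : Fin n, MvPolynomial.X (i, i)}

/-- The ideal `J_n` generated by the 2 × 2 minors and the trace. -/
def tracelessRankOneIdeal (n : ℕ) : Ideal (MvPolynomial (Fin n × Fin n) ℝ) :=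
  minorsIdeal n + traceIdeal n

/-- The complex projective zero locus of an ideal of real polynomials, i.e. the zero locus of
its complexification. -/
def complexZeroLocus {σ : Type} (I : Ideal (MvPolynomial σ ℝ)) : Set (PSpace σ) :=
  projZeroLocus (I.map (MvPolynomial.map (algebraMap ℝ ℂ)) : Set (MvPolynomial σ ℂ))

end

/-! A traceless matrix of rank one is `x yᵀ` with `∑ x_i y_i = 0`, and both halves of the proof use
this.

Geometry: such a matrix has a nonzero off-diagonal entry `(a, b)`. Normalizing `x_a = y_b = 1`, the
trace equation gives `y_a` as a polynomial in the other entries, so the variety is covered by graphs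
over affine space of dimension `(n - 1) + (n - 2)`. Such a cover (`HasAffineCharts`) determines the
dimension, the local dimensions and the tangent spaces, and hence smoothness. The hyperplane `H` is
treated in the same way. For nondegeneracy, a linear form vanishing on a few explicit matrices `x
yᵀ` must be a multiple of the trace.

Degree: substituting `z_ij = x_i y_j` maps forms of degree `d` onto polynomials of bidegree `(d,
d)`. For `d > 0`, a form vanishes on the variety iff its image is divisible by `q = ∑ x_i y_i`
(`mem_vanishingIdealProj_iff_pairingPoly_dvd`). Hence the Hilbert function at `d > 0` is the
dimension in bidegree `(d, d)` minus that in bidegree `(d - 1, d - 1)`, a difference of squares of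
binomial coefficients, whose leading term gives the degree. -/

noncomputable section

theorem le_krullDim_of_lt_succ {α : Type*} [Preorder α] (Z : ℕ → α) {m : ℕ}
    (h : ∀ k < m, Z k < Z (k + 1)) : (m : WithBot ℕ∞) ≤ Order.krullDim α :=
  Order.LTSeries.length_le_krullDim
    { length := m
      toFun := fun k => Z k
      step := fun k => h k k.2 }

/-! ### Affine charts and the dimension of projective sets -/

section ProjectivePoints

variable {σ τ : Type}

theorem isClosed_iff_exists_projZeroLocus {Z : Set (PSpace σ)} :
    IsClosed Z ↔ ∃ T, projZeroLocus T = Z := by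
  rw [← isOpen_compl_iff]
  change Zᶜᶜ ∈ _ ↔ _
  rw [compl_compl]
  rfl

theorem MvPolynomial.IsHomogeneous.eval_smul {f : MvPolynomial σ ℂ} {d : ℕ}
    (hf : f.IsHomogeneous d) (c : ℂ) (v : σ → ℂ) :
    MvPolynomial.eval (c • v) f = c ^ d * MvPolynomial.eval v f := by
  rw [MvPolynomial.eval_eq, MvPolynomial.eval_eq, Finset.mul_sum]
  refine Finset.sum_congr rfl fun m hm => ?_
  have hd : ∑ i ∈ m.support, m i = d := by
    have := hf (MvPolynomial.mem_support_iff.1 hm)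
    rwa [Finsupp.weight_apply, Finsupp.sum, Finset.sum_congr rfl fun i _ => by
      rw [Pi.one_apply, smul_eq_mul, mul_one]] at this
  simp only [Pi.smul_apply, smul_eq_mul, mul_pow, Finset.prod_mul_distrib,
    Finset.prod_pow_eq_pow_sum, hd]
  ring

theorem eval_rep_mk_eq_zero_iff {f : MvPolynomial σ ℂ} {d : ℕ} (hf : f.IsHomogeneous d)
    (v : σ → ℂ) (hv : v ≠ 0) :
    MvPolynomial.eval (Projectivization.mk ℂ v hv).rep f = 0 ↔ MvPolynomial.eval v f = 0 := by
  obtain ⟨a, ha⟩ := Projectivization.exists_smul_eq_mk_rep ℂ v hv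
  have ha' : (a : ℂ) • v = (Projectivization.mk ℂ v hv).rep := ha
  rw [← ha', hf.eval_smul, mul_eq_zero, or_iff_right (pow_ne_zero _ a.ne_zero)]

theorem mk_mem_projZeroLocus {T : Set (MvPolynomial σ ℂ)} {v : σ → ℂ} {hv : v ≠ 0} :
    Projectivization.mk ℂ v hv ∈ projZeroLocus T ↔
      ∀ f ∈ T, (∃ d : ℕ, f.IsHomogeneous d) → MvPolynomial.eval v f = 0 :=
  forall₂_congr fun _ _ => ⟨fun h ⟨d, hd⟩ => (eval_rep_mk_eq_zero_iff hd v hv).1 (h ⟨d, hd⟩),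
    fun h ⟨d, hd⟩ => (eval_rep_mk_eq_zero_iff hd v hv).2 (h ⟨d, hd⟩)⟩

theorem mk_mem_projZeroLocus_singleton {f : MvPolynomial σ ℂ} {d : ℕ} (hf : f.IsHomogeneous d)
    {v : σ → ℂ} {hv : v ≠ 0} :
    Projectivization.mk ℂ v hv ∈ projZeroLocus {f} ↔ MvPolynomial.eval v f = 0 := by
  rw [mk_mem_projZeroLocus]
  simp only [Set.mem_singleton_iff, forall_eq]
  exact ⟨fun h => h ⟨d, hf⟩, fun h _ => h⟩

theorem isClosed_projZeroLocus (T : Set (MvPolynomial σ ℂ)) : IsClosed (projZeroLocus T) :=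
  isClosed_iff_exists_projZeroLocus.2 ⟨T, rfl⟩

/-- Homogenization with respect to the extra variable `none`, to every large degree. -/
theorem exists_homogenization (g : MvPolynomial τ ℂ) :
    ∃ D₀ : ℕ, ∀ D, D₀ ≤ D → ∃ G : MvPolynomial (Option τ) ℂ, G.IsHomogeneous D ∧
      ∀ c : ℂ, c ≠ 0 → ∀ w : τ → ℂ, MvPolynomial.eval (fun o => o.elim c w) G =
        c ^ D * MvPolynomial.eval (fun k => w k / c) g := by
  induction g using MvPolynomial.induction_on with
  | C a =>
    refine ⟨0, fun D _ => ⟨MvPolynomial.C a * MvPolynomial.X none ^ D, ?_, fun c _ w => ?_⟩⟩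
    · simpa using (MvPolynomial.isHomogeneous_C _ a).mul
        ((MvPolynomial.isHomogeneous_X ℂ (none : Option τ)).pow D)
    · simp [mul_comm]
  | add p q hp hq =>
    obtain ⟨D₁, h₁⟩ := hp
    obtain ⟨D₂, h₂⟩ := hq
    refine ⟨max D₁ D₂, fun D hD => ?_⟩
    obtain ⟨G₁, hG₁, e₁⟩ := h₁ D ((le_max_left _ _).trans hD)
    obtain ⟨G₂, hG₂, e₂⟩ := h₂ D ((le_max_right _ _).trans hD)
    exact ⟨G₁ + G₂, hG₁.add hG₂, fun c hc w => by
      rw [map_add, map_add, e₁ c hc, e₂ c hc, mul_add]⟩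
  | mul_X p k hp =>
    obtain ⟨D₁, h₁⟩ := hp
    refine ⟨D₁ + 1, fun D hD => ?_⟩
    obtain ⟨D, rfl⟩ : ∃ E, D = E + 1 := ⟨D - 1, by omega⟩
    obtain ⟨G₁, hG₁, e₁⟩ := h₁ D (by omega)
    refine ⟨G₁ * MvPolynomial.X (some k), hG₁.mul (MvPolynomial.isHomogeneous_X _ _),
      fun c hc w => ?_⟩
    rw [map_mul, map_mul, e₁ c hc, MvPolynomial.eval_X, MvPolynomial.eval_X, pow_succ]
    simp only [Option.elim_some]
    field_simp

/-- The point of projective space with the given polynomial homogeneous coordinates, one of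
which is `1`, at the parameter `u`. -/
def polyPoint {s : σ} {φ : σ → MvPolynomial τ ℂ} (hs : φ s = 1) (u : τ → ℂ) : PSpace σ :=
  Projectivization.mk ℂ (fun i => MvPolynomial.eval u (φ i)) fun h => by
    have := congrFun h s
    simp [hs] at this

/-- A nonempty relatively open subset of the image contains the image of the nonvanishing locus of a
nonzero polynomial. The product of two such polynomials is nonzero, hence nonzero at some point. -/
theorem isIrreducible_range_polyPoint {s : σ} {φ : σ → MvPolynomial τ ℂ} (hs : φ s = 1) :
    IsIrreducible (Set.range (polyPoint hs)) := by
  refine ⟨⟨_, 0, rfl⟩, ?_⟩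
  have key : ∀ U : Set (PSpace σ), IsOpen U → (Set.range (polyPoint hs) ∩ U).Nonempty →
      ∃ g : MvPolynomial τ ℂ, g ≠ 0 ∧ ∀ u, MvPolynomial.eval u g ≠ 0 → polyPoint hs u ∈ U := by
    rintro U hU ⟨_, ⟨u, rfl⟩, hu⟩
    obtain ⟨T, hT⟩ := isClosed_iff_exists_projZeroLocus.1 hU.isClosed_compl
    have h : ∀ u, polyPoint hs u ∈ U ↔ ¬ polyPoint hs u ∈ projZeroLocus T := fun u => by
      rw [hT, Set.mem_compl_iff, not_not]
    rw [h, polyPoint, mk_mem_projZeroLocus] at hu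
    push Not at hu
    obtain ⟨f, hf, hd, h0⟩ := hu
    have e : ∀ u, MvPolynomial.eval u (MvPolynomial.bind₁ φ f) =
        MvPolynomial.eval (fun i => MvPolynomial.eval u (φ i)) f := fun u => by
      rw [MvPolynomial.eval, MvPolynomial.eval₂Hom_bind₁]; rfl
    refine ⟨MvPolynomial.bind₁ φ f, fun h00 => h0 ?_, fun u hu => ?_⟩
    · rw [← e, h00, map_zero]
    · rw [h, polyPoint, mk_mem_projZeroLocus]
      exact fun hh => hu ((e u).trans (hh f hf hd))
  intro U₁ U₂ hU₁ hU₂ h₁ h₂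
  obtain ⟨g₁, h₁, k₁⟩ := key U₁ hU₁ h₁
  obtain ⟨g₂, h₂, k₂⟩ := key U₂ hU₂ h₂
  have : ∃ u, MvPolynomial.eval u (g₁ * g₂) ≠ 0 := by
    by_contra! h
    exact mul_ne_zero h₁ h₂ (MvPolynomial.funext fun u => by rw [h u, map_zero])
  obtain ⟨u, hu⟩ := this
  rw [map_mul] at hu
  exact ⟨_, ⟨u, rfl⟩, k₁ u (left_ne_zero_of_mul hu), k₂ u (right_ne_zero_of_mul hu)⟩

/-- `V ∩ {z_s ≠ 0}` is the graph-like image of the affine space `ℂ^τ` under the polynomial map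
`φ`, whose inverse is given by the coordinates `z_{t k} / z_s`. -/
structure IsAffineChart (V : Set (PSpace σ)) (s : σ) (t : τ → σ)
    (φ : σ → MvPolynomial τ ℂ) : Prop where
  base : φ s = 1
  coord : ∀ k, φ (t k) = MvPolynomial.X k
  mem : ∀ u, polyPoint base u ∈ V
  eq : ∀ v (hv : v ≠ 0), Projectivization.mk ℂ v hv ∈ V → v s ≠ 0 → ∀ i,
    v i = v s * MvPolynomial.eval (fun k => v (t k) / v s) (φ i)

namespace IsAffineChart

variable {V : Set (PSpace σ)} {s : σ} {t : τ → σ} {φ : σ → MvPolynomial τ ℂ}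

theorem polyPoint_eq (h : IsAffineChart V s t φ) {P : PSpace σ} (hP : P ∈ V)
    (hs : P.rep s ≠ 0) : polyPoint h.base (fun k => P.rep (t k) / P.rep s) = P := by
  conv_rhs => rw [← P.mk_rep]
  rw [polyPoint, Projectivization.mk_eq_mk_iff']
  refine ⟨(P.rep s)⁻¹, funext fun i => ?_⟩
  rw [Pi.smul_apply, smul_eq_mul, h.eq P.rep P.rep_nonzero (by rwa [P.mk_rep]) hs i,
    inv_mul_cancel_left₀ hs]

/-- The polynomials on the chart vanishing on the trace of `Z`. -/
def chartIdeal (h : IsAffineChart V s t φ) (Z : Set (PSpace σ)) :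
    Ideal (MvPolynomial τ ℂ) where
  carrier := {g | ∀ u, polyPoint h.base u ∈ Z → MvPolynomial.eval u g = 0}
  zero_mem' := fun _ _ => map_zero _
  add_mem' := fun {f g} hf hg u hu => by rw [map_add, hf u hu, hg u hu, add_zero]
  smul_mem' := fun c f hf u hu => by rw [smul_eq_mul, map_mul, hf u hu, mul_zero]

/-- Homogenize `g` with `z_s` as the extra variable. The additional factor `z_s` puts the hyperplane
at infinity into the closed set, so that covering arguments need only look at the chart. -/
theorem isClosed_zeros (h : IsAffineChart V s t φ) (g : MvPolynomial τ ℂ) :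
    ∃ C : Set (PSpace σ), IsClosed C ∧ (∀ P : PSpace σ, P.rep s = 0 → P ∈ C) ∧
      ∀ u, polyPoint h.base u ∈ C ↔ MvPolynomial.eval u g = 0 := by
  obtain ⟨D, hD⟩ := exists_homogenization g
  obtain ⟨G, hG, e⟩ := hD D le_rfl
  set F : MvPolynomial σ ℂ := MvPolynomial.X s * MvPolynomial.rename (fun o => o.elim s t) G
  have hF : F.IsHomogeneous (1 + D) :=
    (MvPolynomial.isHomogeneous_X ℂ s).mul hG.rename_isHomogeneous
  refine ⟨projZeroLocus {F}, isClosed_projZeroLocus _, fun P hP => ?_, fun u => ?_⟩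
  · rw [← P.mk_rep, mk_mem_projZeroLocus_singleton hF]
    simp [F, hP]
  · rw [polyPoint, mk_mem_projZeroLocus_singleton hF, map_mul, MvPolynomial.eval_X,
      MvPolynomial.eval_rename, h.base, map_one, one_mul]
    have : (fun i => MvPolynomial.eval u (φ i)) ∘ (fun o : Option τ => o.elim s t) =
        fun o => o.elim 1 u := by
      funext o
      cases o <;> simp [h.base, h.coord]
    rw [this, e 1 one_ne_zero]
    simp

/-- If `a * b` vanishes on the chart part of `Z`, the closed sets attached to `a` and `b` cover `Z`,
and irreducibility selects one. Properness holds because `Z` meets the chart. -/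
theorem chartIdeal_isPrime (h : IsAffineChart V s t φ) (Z : TopologicalSpace.IrreducibleCloseds V)
    (hZ : ∃ P ∈ Z, P.1.rep s ≠ 0) : (h.chartIdeal (Subtype.val '' (Z : Set V))).IsPrime := by
  obtain ⟨P, hP, hPs⟩ := hZ
  have hmem : polyPoint h.base (fun k => P.1.rep (t k) / P.1.rep s) ∈
      Subtype.val '' (Z : Set V) := by
    rw [h.polyPoint_eq P.2 hPs]
    exact ⟨P, hP, rfl⟩
  refine ⟨fun h1 => ?_, fun {a b} hab => ?_⟩
  · have : (1 : MvPolynomial τ ℂ) ∈ h.chartIdeal (Subtype.val '' (Z : Set V)) := by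
      rw [h1]; trivial
    simpa using this _ hmem
  · obtain ⟨A, hA, hA', hA''⟩ := h.isClosed_zeros a
    obtain ⟨B, hB, hB', hB''⟩ := h.isClosed_zeros b
    have hcov : (Z : Set V) ⊆ Subtype.val ⁻¹' A ∪ Subtype.val ⁻¹' B := by
      intro Q hQ
      by_cases hQs : Q.1.rep s = 0
      · exact Or.inl (hA' _ hQs)
      · have hQe := h.polyPoint_eq Q.2 hQs
        have h0 := hab (fun k => Q.1.rep (t k) / Q.1.rep s) ⟨Q, hQ, hQe.symm⟩
        rw [map_mul, mul_eq_zero] at h0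
        refine h0.imp (fun h0 => ?_) fun h0 => ?_
        · have := (hA'' _).2 h0
          rwa [hQe] at this
        · have := (hB'' _).2 h0
          rwa [hQe] at this
    refine (isPreirreducible_iff_isClosed_union_isClosed.1 Z.isIrreducible.isPreirreducible _ _
      (hA.preimage continuous_subtype_val) (hB.preimage continuous_subtype_val) hcov).imp ?_ ?_
    · rintro hs u ⟨Q, hQ, hQu⟩
      exact (hA'' u).1 (hQu ▸ hs hQ)
    · rintro hs u ⟨Q, hQ, hQu⟩
      exact (hB'' u).1 (hQu ▸ hs hQ)

/-- Equal ideals would give `Z' ⊆ Z ∪ {z_s = 0}`. As `Z'` is irreducible and meets the chart, it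
would lie in `Z`. -/
theorem chartIdeal_lt (h : IsAffineChart V s t φ)
    {Z Z' : TopologicalSpace.IrreducibleCloseds V} (hZ' : ∃ P ∈ Z', P.1.rep s ≠ 0)
    (hlt : Z < Z') : h.chartIdeal (Subtype.val '' (Z' : Set V)) <
      h.chartIdeal (Subtype.val '' (Z : Set V)) := by
  refine lt_of_le_of_ne (fun g hg u ⟨Q, hQ, hQu⟩ => hg u ⟨Q, hlt.le hQ, hQu⟩) fun heq => ?_
  obtain ⟨C, hC, hCZ⟩ := isClosed_induced_iff.1 Z.isClosed
  obtain ⟨T, rfl⟩ := isClosed_iff_exists_projZeroLocus.1 hC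
  have hcov : (Z' : Set V) ⊆ Z ∪ Subtype.val ⁻¹' (projZeroLocus {MvPolynomial.X s}) := by
    intro Q hQ
    by_cases hQs : Q.1.rep s = 0
    · right
      change Q.1 ∈ projZeroLocus _
      rw [← Q.1.mk_rep, mk_mem_projZeroLocus_singleton (MvPolynomial.isHomogeneous_X ℂ s)]
      simpa using hQs
    · left
      rw [← hCZ]
      change Q.1 ∈ projZeroLocus _
      have hQe := h.polyPoint_eq Q.2 hQs
      rw [← hQe, polyPoint, mk_mem_projZeroLocus]
      intro f hf hd
      have e : ∀ u, MvPolynomial.eval u (MvPolynomial.bind₁ φ f) =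
          MvPolynomial.eval (fun i => MvPolynomial.eval u (φ i)) f := fun u => by
        rw [MvPolynomial.eval, MvPolynomial.eval₂Hom_bind₁]; rfl
      have hfZ : MvPolynomial.bind₁ φ f ∈ h.chartIdeal (Subtype.val '' (Z : Set V)) := by
        rintro u ⟨R, hR, hRu⟩
        rw [← hCZ] at hR
        change R.1 ∈ projZeroLocus T at hR
        rw [hRu, polyPoint, mk_mem_projZeroLocus] at hR
        rw [e]
        exact hR f hf hd
      rw [← heq] at hfZ
      rw [← e]
      exact hfZ _ ⟨Q, hQ, hQe.symm⟩
  rcases isPreirreducible_iff_isClosed_union_isClosed.1 Z'.isIrreducible.isPreirreducible _ _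
    Z.isClosed ((isClosed_projZeroLocus _).preimage continuous_subtype_val) hcov with h1 | h1
  · exact hlt.not_ge h1
  · obtain ⟨P, hP, hPs⟩ := hZ'
    have := h1 hP
    change P.1 ∈ projZeroLocus {MvPolynomial.X s} at this
    rw [← P.1.mk_rep, mk_mem_projZeroLocus_singleton (MvPolynomial.isHomogeneous_X ℂ s)] at this
    exact hPs (by simpa using this)

end IsAffineChart

/-- `V` is covered by open subsets parametrized by affine `m`-space. -/
def HasAffineCharts (V : Set (PSpace σ)) (m : ℕ) : Prop :=
  ∀ P ∈ V, ∃ (τ : Type) (_ : Fintype τ) (s : σ) (t : τ → σ) (φ : σ → MvPolynomial τ ℂ),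
    Fintype.card τ = m ∧ IsAffineChart V s t φ ∧ P.rep s ≠ 0

/-- A point of the smallest member of a chain lies in all members, so one chart around it sees the
whole chain. Passing to ideals reverses it into a chain of primes in a polynomial ring in `m`
variables. -/
theorem HasAffineCharts.projDim_le {V : Set (PSpace σ)} {m : ℕ} (h : HasAffineCharts V m) :
    projDim V ≤ (m : WithBot ℕ∞) := by
  refine iSup_le fun c => ?_
  obtain ⟨P, hP⟩ := c.head.isIrreducible.nonempty
  obtain ⟨τ, _, s, t, φ, rfl, hc, hPs⟩ := h P.1 P.2
  have hmeet : ∀ i, ∃ Q ∈ c i, Q.1.rep s ≠ 0 := fun i =>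
    ⟨P, (c.monotone (Fin.zero_le i)) hP, hPs⟩
  have hdim : ringKrullDim (MvPolynomial τ ℂ) = (Fintype.card τ : WithBot ℕ∞) := by
    rw [MvPolynomial.ringKrullDim_of_isNoetherianRing, ringKrullDim_eq_zero_of_field, zero_add,
      Nat.card_eq_fintype_card]
  rw [← hdim]
  let d : LTSeries (PrimeSpectrum (MvPolynomial τ ℂ)) :=
    { length := c.length
      toFun := fun i => ⟨_, hc.chartIdeal_isPrime (c i.rev) (hmeet _)⟩
      step := fun i => by
        change hc.chartIdeal _ < hc.chartIdeal _
        refine hc.chartIdeal_lt (hmeet _) (c.strictMono ?_)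
        rw [Fin.rev_lt_rev]
        exact Fin.castSucc_lt_succ }
  exact Order.LTSeries.length_le_krullDim d

/-- The chart carries a flag of coordinate subspaces through the parameter `p` of `P`: in `L k` all
parameters of index at least `k` are frozen at `p`. The closures in `V ∩ W` of the traces of the `L
k` form the required chain. -/
theorem IsAffineChart.le_projDim_inter [Fintype τ] {V : Set (PSpace σ)} {s : σ} {t : τ → σ}
    {φ : σ → MvPolynomial τ ℂ} (h : IsAffineChart V s t φ) {P : PSpace σ} (hP : P ∈ V)
    (hs : P.rep s ≠ 0) {W : Set (PSpace σ)} (hW : IsOpen W) (hPW : P ∈ W) :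
    (Fintype.card τ : WithBot ℕ∞) ≤ projDim (V ∩ W) := by
  set p : τ → ℂ := fun k => P.rep (t k) / P.rep s
  have hpP : polyPoint h.base p = P := h.polyPoint_eq hP hs
  let e := Fintype.equivFin τ
  let Φ : ℕ → σ → MvPolynomial τ ℂ := fun k i =>
    MvPolynomial.bind₁ (fun j => if (e j : ℕ) < k then MvPolynomial.X j
      else MvPolynomial.C (p j)) (φ i)
  have hΦs : ∀ k, Φ k s = 1 := fun k => by simp only [Φ, h.base, map_one]
  let sub : ℕ → (τ → ℂ) → τ → ℂ := fun k u j => if (e j : ℕ) < k then u j else p j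
  have hpt : ∀ k u, polyPoint (hΦs k) u = polyPoint h.base (sub k u) := fun k u => by
    unfold polyPoint
    congr 1
    funext i
    simp only [Φ, sub]
    rw [MvPolynomial.eval, MvPolynomial.eval₂Hom_bind₁]
    change MvPolynomial.eval _ _ = _
    congr 2
    funext j
    split_ifs <;> simp
  let L : ℕ → Set (PSpace σ) := fun k => Set.range (polyPoint (hΦs k))
  have hL : ∀ k, IsIrreducible (L k) := fun k => isIrreducible_range_polyPoint _
  have hLV : ∀ k, L k ⊆ V := by
    rintro k _ ⟨u, rfl⟩
    rw [hpt]
    exact h.mem _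
  have hPL : ∀ k, P ∈ L k := fun k => ⟨p, by
    rw [hpt]
    convert hpP using 2
    funext j
    simp [sub]⟩
  have hmono : ∀ k, L k ⊆ L (k + 1) := by
    rintro k _ ⟨u, rfl⟩
    refine ⟨sub k u, ?_⟩
    rw [hpt, hpt]
    congr 1
    funext j
    simp only [sub]
    split_ifs <;> first | rfl | omega
  let A : ℕ → Set ↥(V ∩ W) := fun k => Subtype.val ⁻¹' L k
  have hA : ∀ k, IsIrreducible (A k) := by
    refine fun k => ⟨⟨⟨P, hP, hPW⟩, hPL k⟩, ?_⟩
    rintro u v hu hv ⟨x, hx, hxu⟩ ⟨y, hy, hyv⟩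
    obtain ⟨u, hu', rfl⟩ := isOpen_induced_iff.1 hu
    obtain ⟨v, hv', rfl⟩ := isOpen_induced_iff.1 hv
    obtain ⟨z, hz, hzu, hzv⟩ := (hL k).isPreirreducible (u ∩ W) (v ∩ W) (hu'.inter hW)
      (hv'.inter hW) ⟨x, hx, hxu, x.2.2⟩ ⟨y, hy, hyv, y.2.2⟩
    exact ⟨⟨z, hLV k hz, hzu.2⟩, hz, hzu.1, hzv.1⟩
  let Z : ℕ → TopologicalSpace.IrreducibleCloseds ↥(V ∩ W) := fun k =>
    ⟨closure (A k), (hA k).closure, isClosed_closure⟩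
  have hZ : ∀ k < Fintype.card τ, Z k < Z (k + 1) := by
    refine fun k hk => lt_of_le_of_ne (show closure (A k) ⊆ closure (A (k + 1)) from
      closure_mono (Set.preimage_mono (hmono k))) fun heq => ?_
    have heq' : closure (A k) = closure (A (k + 1)) :=
      congrArg TopologicalSpace.IrreducibleCloseds.carrier heq
    set j := e.symm ⟨k, hk⟩ with hj
    have hej : (e j : ℕ) = k := by simp [hj]
    -- On the chart this form cuts out `u j = p j`, which holds on `L k` but not on `L (k + 1)`.
    -- Irreducibility of `L (k + 1)` then supplies a point off this locus that also lies in `W`.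
    set f : MvPolynomial σ ℂ := MvPolynomial.X (t j) - MvPolynomial.C (p j) * MvPolynomial.X s
    have hf : f.IsHomogeneous 1 := (MvPolynomial.isHomogeneous_X ℂ _).sub
      (by
        simpa using (MvPolynomial.isHomogeneous_C σ (p j)).mul
          (MvPolynomial.isHomogeneous_X ℂ s))
    have hfu : ∀ u, polyPoint h.base u ∈ projZeroLocus {f} ↔ u j = p j := fun u => by
      rw [polyPoint, mk_mem_projZeroLocus_singleton hf]
      simp [f, h.base, h.coord, sub_eq_zero]
    have hsub : closure (A k) ⊆ Subtype.val ⁻¹' projZeroLocus {f} := by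
      refine closure_minimal ?_ ((isClosed_projZeroLocus _).preimage continuous_subtype_val)
      refine Set.preimage_mono ?_
      rintro _ ⟨u, rfl⟩
      rw [hpt, hfu]
      simp [sub, hej]
    have hne : (L (k + 1) ∩ (projZeroLocus {f})ᶜ).Nonempty := by
      refine ⟨_, ⟨fun i => p i + 1, rfl⟩, ?_⟩
      rw [Set.mem_compl_iff, hpt, hfu]
      simp [sub, hej]
    obtain ⟨x, hx, hxW, hxf⟩ := (hL (k + 1)).isPreirreducible W _ hW
      (isClosed_projZeroLocus _).isOpen_compl ⟨P, hPL _, hPW⟩ hne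
    have hx' : (⟨x, hLV _ hx, hxW⟩ : ↥(V ∩ W)) ∈ closure (A (k + 1)) := subset_closure hx
    rw [← heq'] at hx'
    exact (Set.mem_compl_iff _ _).1 hxf (Set.mem_preimage.1 (hsub hx'))
  exact le_krullDim_of_lt_succ Z hZ

theorem HasAffineCharts.projDim_eq {V : Set (PSpace σ)} {m : ℕ} (h : HasAffineCharts V m)
    (hne : V.Nonempty) : projDim V = (m : WithBot ℕ∞) := by
  refine le_antisymm h.projDim_le ?_
  obtain ⟨P, hP⟩ := hne
  obtain ⟨τ, _, s, t, φ, rfl, hc, hs⟩ := h P hP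
  simpa using hc.le_projDim_inter hP hs isOpen_univ (Set.mem_univ P)

theorem HasAffineCharts.localProjDim_eq {V : Set (PSpace σ)} {m : ℕ} (h : HasAffineCharts V m)
    {P : PSpace σ} (hP : P ∈ V) : localProjDim V P = (m : WithBot ℕ∞) := by
  refine le_antisymm ?_ (le_iInf fun U => ?_)
  · refine (iInf_le _ ⟨Set.univ, isOpen_univ, Set.mem_univ P⟩).trans ?_
    simpa using h.projDim_le
  · obtain ⟨τ, _, s, t, φ, rfl, hc, hs⟩ := h P hP
    exact hc.le_projDim_inter hP hs U.2.1 U.2.2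

end ProjectivePoints

end

noncomputable section

/-! ### Tangent spaces and smoothness from charts -/

section TangentSpaces

variable {σ τ : Type}

theorem MvPolynomial.pderiv_bind₁ [Fintype σ] (Φ : σ → MvPolynomial τ ℂ) (o : τ)
    (f : MvPolynomial σ ℂ) :
    MvPolynomial.pderiv o (MvPolynomial.bind₁ Φ f) =
      ∑ i, MvPolynomial.bind₁ Φ (MvPolynomial.pderiv i f) * MvPolynomial.pderiv o (Φ i) := by
  classical
  induction f using MvPolynomial.induction_on with
  | C a => simp
  | add p q hp hq => simp only [map_add, hp, hq, add_mul, Finset.sum_add_distrib]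
  | mul_X p j hp =>
    have h : ∀ i, MvPolynomial.bind₁ Φ (MvPolynomial.pderiv i (p * MvPolynomial.X j)) *
        MvPolynomial.pderiv o (Φ i) =
        MvPolynomial.bind₁ Φ (MvPolynomial.pderiv i p) * MvPolynomial.pderiv o (Φ i) * Φ j +
          if i = j then MvPolynomial.bind₁ Φ p * MvPolynomial.pderiv o (Φ i) else 0 := by
      intro i
      rw [MvPolynomial.pderiv_mul, map_add, map_mul, map_mul, MvPolynomial.bind₁_X_right]
      split_ifs with hij
      · rw [hij, MvPolynomial.pderiv_X_self, map_one]
        ring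
      · rw [MvPolynomial.pderiv_X_of_ne (Ne.symm hij), map_zero]
        ring
    rw [map_mul, MvPolynomial.bind₁_X_right, MvPolynomial.pderiv_mul, hp, Finset.sum_mul,
      Finset.sum_congr rfl fun i _ => h i, Finset.sum_add_distrib, Finset.sum_ite_eq' Finset.univ j]
    simp only [Finset.mem_univ, if_true]

theorem MvPolynomial.pderiv_rename_of_notMem_range {f : τ → σ} {i : σ} (hi : i ∉ Set.range f)
    (G : MvPolynomial τ ℂ) : MvPolynomial.pderiv i (MvPolynomial.rename f G) = 0 := by
  classical
  refine MvPolynomial.pderiv_eq_zero_of_notMem_vars fun h => ?_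
  obtain ⟨k, -, rfl⟩ := Finset.mem_image.1 (MvPolynomial.vars_rename f G h)
  exact hi ⟨k, rfl⟩

namespace IsAffineChart

variable {V : Set (PSpace σ)} {s : σ} {t : τ → σ} {φ : σ → MvPolynomial τ ℂ}

/-- For a non-chart coordinate `r`, the graph equation homogenizes to `F = z_s ^ (D + 1) z_r - (a
form in the chart coordinates)`. Its differential at `P`, applied to a vector whose chart
coordinates vanish, is a nonzero multiple of `w r`. -/
theorem eq_zero_of_mem_affineTangentSpace [Fintype σ] (h : IsAffineChart V s t φ)
    {P : PSpace σ} (hs : P.rep s ≠ 0) {w : σ → ℂ} (hw : w ∈ affineTangentSpace V P)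
    (hw0 : ∀ o : Option τ, w (o.elim s t) = 0) : w = 0 := by
  classical
  funext r
  by_cases hr : r ∈ Set.range (fun o : Option τ => o.elim s t)
  · obtain ⟨o, rfl⟩ := hr
    exact hw0 o
  obtain ⟨D, hD⟩ := exists_homogenization (φ r)
  -- The positive exponent `D + 1`, with the factor `X none` below, makes `F` vanish also on the
  -- points of `V` with `z_s = 0`.
  obtain ⟨G, -, e⟩ := hD (D + 1) (by omega)
  set F : MvPolynomial σ ℂ := MvPolynomial.X s ^ (D + 1) * MvPolynomial.X r -
    MvPolynomial.rename (fun o : Option τ => o.elim s t) (MvPolynomial.X none * G) with hF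
  have hFV : F ∈ vanishingIdealProj V := by
    intro v hv hvV
    by_cases hvs : v s = 0
    · simp [hF, hvs]
    · have hcomp : v ∘ (fun o : Option τ => o.elim s t) = fun o => o.elim (v s) (v ∘ t) := by
        funext o
        cases o <;> rfl
      rw [hF, map_sub, map_mul, map_pow, MvPolynomial.eval_X, MvPolynomial.eval_X,
        MvPolynomial.eval_rename, map_mul, hcomp, e _ hvs, MvPolynomial.eval_X,
        h.eq v hv hvV hvs r]
      simp only [Option.elim_none, Function.comp_apply]
      ring
  have hsum := hw F hFV
  rw [Finset.sum_eq_single r] at hsum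
  · rw [hF, map_sub, MvPolynomial.pderiv_rename_of_notMem_range hr, sub_zero,
      MvPolynomial.pderiv_mul, MvPolynomial.pderiv_pow,
      MvPolynomial.pderiv_X_of_ne (show s ≠ r from fun hh => hr ⟨none, hh⟩), MvPolynomial.pderiv_X_self] at hsum
    simpa [hs] using hsum
  · intro i _ hir
    by_cases hi : i ∈ Set.range (fun o : Option τ => o.elim s t)
    · obtain ⟨o, rfl⟩ := hi
      rw [hw0, mul_zero]
    · rw [hF, map_sub, MvPolynomial.pderiv_rename_of_notMem_range hi, sub_zero,
        MvPolynomial.pderiv_mul, MvPolynomial.pderiv_pow,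
        MvPolynomial.pderiv_X_of_ne (show s ≠ i from fun hh => hi ⟨none, hh⟩),
        MvPolynomial.pderiv_X_of_ne hir.symm]
      simp
  · simp

/-- The cone over the chart is parametrized by `(c, u) ↦ c • φ(u)`. Where `c = 0` there is no
projective point, so vanishing is checked after multiplying by the variable `c`, which is then
cancelled. -/
theorem bind₁_cone_eq_zero (h : IsAffineChart V s t φ) {f : MvPolynomial σ ℂ}
    (hf : f ∈ vanishingIdealProj V) :
    MvPolynomial.bind₁ (fun i => MvPolynomial.X (none : Option τ) *
      MvPolynomial.rename some (φ i)) f = 0 := by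
  refine (mul_eq_zero.1 (?_ : MvPolynomial.X (none : Option τ) * _ = 0)).resolve_left
    (MvPolynomial.X_ne_zero _)
  refine MvPolynomial.funext fun q => ?_
  rw [map_mul, MvPolynomial.eval_X, map_zero]
  by_cases hq : q none = 0
  · rw [hq, zero_mul]
  have e : MvPolynomial.eval q (MvPolynomial.bind₁ (fun i => MvPolynomial.X (none : Option τ) *
      MvPolynomial.rename some (φ i)) f) = MvPolynomial.eval
        (q none • fun i => MvPolynomial.eval (q ∘ some) (φ i)) f := by
    rw [MvPolynomial.eval, MvPolynomial.eval₂Hom_bind₁]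
    change MvPolynomial.eval _ _ = _
    congr 2
    funext i
    change MvPolynomial.eval q _ = _
    rw [map_mul, MvPolynomial.eval_rename, MvPolynomial.eval_X]
    rfl
  have h0 : (fun i => MvPolynomial.eval (q ∘ some) (φ i)) ≠ 0 := fun h0 => by
    have := congrFun h0 s
    simp [h.base] at this
  rw [e, hf _ (smul_ne_zero hq h0), mul_zero]
  have := h.mem (q ∘ some)
  rw [polyPoint] at this
  convert this using 1
  rw [Projectivization.mk_eq_mk_iff']
  exact ⟨q none, rfl⟩

/-- The vector is the image of `q` under the differential of the cone parametrization at `(c, u)`.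
The chain rule applied to the zero polynomial of `bind₁_cone_eq_zero` shows that it is tangent. -/
theorem tangent_mem [Fintype σ] [Fintype τ] (h : IsAffineChart V s t φ) {P : PSpace σ}
    {c : ℂ} {u : τ → ℂ} (hP : ∀ i, P.rep i = c * MvPolynomial.eval u (φ i))
    (q : Option τ → ℂ) :
    (fun i => q none * MvPolynomial.eval u (φ i) +
      c * ∑ k, q (some k) * MvPolynomial.eval u (MvPolynomial.pderiv k (φ i))) ∈
      affineTangentSpace V P := by
  classical
  intro f hf
  set Φ : σ → MvPolynomial (Option τ) ℂ := fun i => MvPolynomial.X (none : Option τ) *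
    MvPolynomial.rename some (φ i) with hΦ
  set x : Option τ → ℂ := fun o => o.elim c u with hx
  have hxs : x ∘ some = u := rfl
  have hev : ∀ g : MvPolynomial σ ℂ, MvPolynomial.eval x (MvPolynomial.bind₁ Φ g) =
      MvPolynomial.eval P.rep g := fun g => by
    rw [MvPolynomial.eval, MvPolynomial.eval₂Hom_bind₁]
    change MvPolynomial.eval _ _ = _
    congr 2
    funext i
    change MvPolynomial.eval x _ = _
    rw [hP, map_mul, MvPolynomial.eval_rename, MvPolynomial.eval_X]
    rfl
  have hz : ∀ o, ∑ i, MvPolynomial.eval P.rep (MvPolynomial.pderiv i f) *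
      MvPolynomial.eval x (MvPolynomial.pderiv o (Φ i)) = 0 := fun o => by
    have := congrArg (fun g => MvPolynomial.eval x (MvPolynomial.pderiv o g))
      (h.bind₁_cone_eq_zero hf)
    simp only [map_zero] at this
    rw [MvPolynomial.pderiv_bind₁] at this
    rw [map_sum] at this
    rw [← this]
    exact Finset.sum_congr rfl fun i _ => by
      rw [(MvPolynomial.eval x).map_mul, ← hev]
  have hnone : ∀ i, MvPolynomial.eval x (MvPolynomial.pderiv none (Φ i)) =
      MvPolynomial.eval u (φ i) := fun i => by
    simp only [hΦ]
    rw [MvPolynomial.pderiv_mul, MvPolynomial.pderiv_X_self,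
      MvPolynomial.pderiv_rename_of_notMem_range (by simp), mul_zero, add_zero, one_mul,
      MvPolynomial.eval_rename, hxs]
  have hsome : ∀ i k, MvPolynomial.eval x (MvPolynomial.pderiv (some k) (Φ i)) =
      c * MvPolynomial.eval u (MvPolynomial.pderiv k (φ i)) := fun i k => by
    simp only [hΦ]
    rw [MvPolynomial.pderiv_mul, MvPolynomial.pderiv_X_of_ne (by simp),
      MvPolynomial.pderiv_rename (Option.some_injective τ), zero_mul, zero_add, map_mul,
      MvPolynomial.eval_rename, hxs, MvPolynomial.eval_X]
    rfl
  have htot : ∑ o, q o * ∑ i, MvPolynomial.eval P.rep (MvPolynomial.pderiv i f) *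
      MvPolynomial.eval x (MvPolynomial.pderiv o (Φ i)) = 0 :=
    Finset.sum_eq_zero fun o _ => by rw [hz, mul_zero]
  rw [← htot, Fintype.sum_option]
  simp only [Finset.mul_sum, hnone, hsome, mul_add, Finset.sum_add_distrib]
  congr 1
  · exact Finset.sum_congr rfl fun i _ => by ring
  · rw [Finset.sum_comm]
    exact Finset.sum_congr rfl fun i _ => Finset.sum_congr rfl fun k _ => by ring

/-- Reading off the chart coordinates is injective on the tangent space, which gives the upper
bound. The differential of the cone parametrization is injective because the coordinates `s` and `t
k` recover `q`, which gives the lower bound. -/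
theorem finrank_affineTangentSpace [Fintype σ] [Fintype τ] (h : IsAffineChart V s t φ)
    {P : PSpace σ} (hP : P ∈ V) (hs : P.rep s ≠ 0) :
    Module.finrank ℂ (affineTangentSpace V P) = Fintype.card τ + 1 := by
  classical
  apply le_antisymm
  · have hinj : Function.Injective ((LinearMap.funLeft ℂ ℂ (fun o : Option τ => o.elim s t)).comp
        (affineTangentSpace V P).subtype) := by
      rw [injective_iff_map_eq_zero]
      rintro ⟨w, hw⟩ h0
      rw [Submodule.mk_eq_zero]
      exact h.eq_zero_of_mem_affineTangentSpace hs hw fun o => congrFun h0 o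
    simpa using LinearMap.finrank_le_finrank_of_injective hinj
  · set c := P.rep s with hc
    set u : τ → ℂ := fun k => P.rep (t k) / P.rep s with hu
    have hPc : ∀ i, P.rep i = c * MvPolynomial.eval u (φ i) :=
      h.eq P.rep P.rep_nonzero (by rwa [P.mk_rep]) hs
    let ℓ : (Option τ → ℂ) →ₗ[ℂ] affineTangentSpace V P :=
      { toFun := fun q => ⟨_, h.tangent_mem hPc q⟩
        map_add' := fun q q' => Subtype.ext <| funext fun i => by
          simp only [Pi.add_apply, Submodule.coe_add, add_mul, Finset.sum_add_distrib]
          ring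
        map_smul' := fun a q => Subtype.ext <| funext fun i => by
          simp only [Pi.smul_apply, smul_eq_mul, RingHom.id_apply, Submodule.coe_smul,
            mul_assoc, ← Finset.mul_sum]
          ring }
    have hinj : Function.Injective ℓ := by
      rw [injective_iff_map_eq_zero]
      intro q hq
      have hq' : ∀ i, q none * MvPolynomial.eval u (φ i) +
          c * ∑ k, q (some k) * MvPolynomial.eval u (MvPolynomial.pderiv k (φ i)) = 0 :=
        fun i => congrFun (congrArg Subtype.val hq) i
      have h0 : q none = 0 := by simpa [h.base] using hq' s
      funext o
      cases o with
      | none => exact h0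
      | some k => simpa [h.coord, h0, MvPolynomial.pderiv_X, Pi.single_apply,
          apply_ite, hs] using hq' (t k)
    simpa using LinearMap.finrank_le_finrank_of_injective hinj

end IsAffineChart

theorem HasAffineCharts.isSmoothProj [Fintype σ] {V : Set (PSpace σ)} {m : ℕ}
    (h : HasAffineCharts V m) : IsSmoothProj V := by
  intro P hP
  rw [h.localProjDim_eq hP]
  obtain ⟨τ, _, s, t, φ, rfl, hc, hs⟩ := h P hP
  rw [hc.finrank_affineTangentSpace hP hs]
  norm_cast

end TangentSpaces

end

noncomputable section

/-! ### Charts and nondegeneracy for traceless rank-one matrices -/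

section TracelessRankOne

theorem mk_mem_complexZeroLocus_span {σ : Type} {S : Set (MvPolynomial σ ℝ)}
    (hS : ∀ f ∈ S, ∃ d : ℕ, f.IsHomogeneous d) {v : σ → ℂ} {hv : v ≠ 0} :
    Projectivization.mk ℂ v hv ∈ complexZeroLocus (Ideal.span S) ↔
      ∀ f ∈ S, MvPolynomial.eval v (MvPolynomial.map (algebraMap ℝ ℂ) f) = 0 := by
  rw [complexZeroLocus, mk_mem_projZeroLocus, Ideal.map_span]
  constructor
  · intro h f hf
    obtain ⟨d, hd⟩ := hS f hf
    exact h _ (Ideal.subset_span ⟨f, hf, rfl⟩) ⟨d, hd.map _⟩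
  · intro h f hf _
    have hle : Ideal.span (MvPolynomial.map (algebraMap ℝ ℂ) '' S) ≤
        RingHom.ker (MvPolynomial.eval v) := by
      rw [Ideal.span_le]
      rintro _ ⟨g, hg, rfl⟩
      exact h g hg
    exact hle hf

variable {n : ℕ}

theorem mk_mem_complexZeroLocus_traceIdeal {v : Fin n × Fin n → ℂ} {hv : v ≠ 0} :
    Projectivization.mk ℂ v hv ∈ complexZeroLocus (traceIdeal n) ↔ ∑ i, v (i, i) = 0 := by
  rw [traceIdeal, mk_mem_complexZeroLocus_span]
  · simp
  · rintro f rfl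
    exact ⟨1, MvPolynomial.IsHomogeneous.sum _ _ _ fun i _ => MvPolynomial.isHomogeneous_X _ _⟩

theorem mk_mem_complexZeroLocus_tracelessRankOneIdeal {v : Fin n × Fin n → ℂ} {hv : v ≠ 0} :
    Projectivization.mk ℂ v hv ∈ complexZeroLocus (tracelessRankOneIdeal n) ↔
      (∀ i j k l, v (i, j) * v (k, l) = v (i, l) * v (k, j)) ∧ ∑ i, v (i, i) = 0 := by
  rw [tracelessRankOneIdeal, minorsIdeal, traceIdeal, Submodule.add_eq_sup, ← Ideal.span_union,
    mk_mem_complexZeroLocus_span]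
  · constructor
    · refine fun h => ⟨fun i j k l => ?_, ?_⟩
      · have := h _ (Or.inl ⟨i, j, k, l, rfl⟩)
        simpa [sub_eq_zero] using this
      · simpa using h _ (Or.inr rfl)
    · rintro ⟨h₁, h₂⟩ f (⟨i, j, k, l, rfl⟩ | rfl)
      · simpa [sub_eq_zero] using h₁ i j k l
      · simpa using h₂
  · rintro f (⟨i, j, k, l, rfl⟩ | rfl)
    · exact ⟨2, ((MvPolynomial.isHomogeneous_X _ _).mul (MvPolynomial.isHomogeneous_X _ _)).sub
        ((MvPolynomial.isHomogeneous_X _ _).mul (MvPolynomial.isHomogeneous_X _ _))⟩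
    · exact ⟨1, MvPolynomial.IsHomogeneous.sum _ _ _ fun i _ => MvPolynomial.isHomogeneous_X _ _⟩

theorem mk_outer_mem {x y : Fin n → ℂ} (hxy : ∑ i, x i * y i = 0)
    (hv : (fun p : Fin n × Fin n => x p.1 * y p.2) ≠ 0) :
    Projectivization.mk ℂ _ hv ∈ complexZeroLocus (tracelessRankOneIdeal n) :=
  mk_mem_complexZeroLocus_tracelessRankOneIdeal.2 ⟨fun i j k l => by ring, hxy⟩

theorem hasAffineCharts_tracelessRankOneIdeal :
    HasAffineCharts (complexZeroLocus (tracelessRankOneIdeal n)) (2 * n - 3) := by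
  intro P hP
  have hP' := hP
  rw [← P.mk_rep, mk_mem_complexZeroLocus_tracelessRankOneIdeal] at hP'
  obtain ⟨hm, htr⟩ := hP'
  -- For a diagonal matrix the minors give `z_ii z_jj = 0`, so `z_ii` times the trace is `z_ii ^ 2`.
  -- Trace zero would then make the matrix zero.
  obtain ⟨a, b, hab, hPab⟩ : ∃ a b, a ≠ b ∧ P.rep (a, b) ≠ 0 := by
    by_contra! h
    have hd : ∀ i j, i ≠ j → P.rep (i, i) * P.rep (j, j) = 0 := fun i j hij => by
      rw [hm i i j j, h i j hij, zero_mul]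
    refine P.rep_nonzero (funext fun ⟨i, j⟩ => ?_)
    by_cases hij : i = j
    · subst hij
      have : P.rep (i, i) * ∑ j, P.rep (j, j) = P.rep (i, i) * P.rep (i, i) := by
        rw [Finset.mul_sum, Finset.sum_eq_single i (fun j _ hj => hd i j hj.symm) (by simp)]
      rw [htr, mul_zero] at this
      simpa using this.symm
    · exact h i j hij
  let τ : Type := {i : Fin n // i ≠ a} ⊕ {j : Fin n // j ≠ b ∧ j ≠ a}
  let x : Fin n → MvPolynomial τ ℂ := fun i =>
    if h : i = a then 1 else MvPolynomial.X (Sum.inl ⟨i, h⟩)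
  let y' : Fin n → MvPolynomial τ ℂ := fun j =>
    if hb : j = b then 1 else if ha : j = a then 0 else MvPolynomial.X (Sum.inr ⟨j, hb, ha⟩)
  -- `y'` has entry `0` in slot `a`. Since `x a = 1`, subtracting `∑ x_i y'_i` there makes the
  -- pairing of `x` and `y` vanish identically.
  let y : Fin n → MvPolynomial τ ℂ := fun j => y' j - if j = a then ∑ i, x i * y' i else 0
  have hxa : x a = 1 := by simp [x]
  have hyb : y b = 1 := by simp [y, y', hab.symm]
  refine ⟨τ, inferInstance, (a, b), Sum.elim (fun i => (i.1, b)) (fun j => (a, j.1)),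
    fun p => x p.1 * y p.2, ?_, ⟨?_, ?_, ?_, ?_⟩, hPab⟩
  · have h1 : Fintype.card {j : Fin n // j ≠ b ∧ j ≠ a} = n - 2 := by
      rw [Fintype.card_subtype]
      have : (Finset.univ.filter fun j : Fin n => j ≠ b ∧ j ≠ a) = {b, a}ᶜ := by
        ext j; simp
      rw [this, Finset.card_compl, Finset.card_pair hab.symm, Fintype.card_fin]
    have h2 : Fintype.card {i : Fin n // i ≠ a} = n - 1 := by
      simp [Fintype.card_subtype_compl]
    have h3 : 2 ≤ n := by
      have := a.2
      have := b.2
      have := Fin.val_ne_of_ne hab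
      omega
    rw [Fintype.card_sum, h1, h2]
    omega
  · simp [hxa, hyb]
  · rintro (⟨i, hi⟩ | ⟨j, hjb, hja⟩)
    · simp only [Sum.elim_inl, hyb, mul_one]
      simp [x, hi]
    · simp only [Sum.elim_inr, hxa, one_mul]
      simp [y, y', hjb, hja]
  · intro u
    rw [polyPoint, mk_mem_complexZeroLocus_tracelessRankOneIdeal]
    refine ⟨fun i j k l => by simp only [map_mul]; ring, ?_⟩
    rw [← map_sum]
    have : ∑ i, x i * y i = 0 := by
      simp only [y, mul_sub, Finset.sum_sub_distrib, mul_ite, mul_zero, Finset.sum_ite_eq',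
        Finset.mem_univ, if_true, hxa, one_mul, sub_self]
    rw [this, map_zero]
  · rintro v hv hvV hvs ⟨i, j⟩
    rw [mk_mem_complexZeroLocus_tracelessRankOneIdeal] at hvV
    obtain ⟨hm, htr⟩ := hvV
    set w : τ → ℂ := fun k => v (Sum.elim (fun i => (i.1, b)) (fun j => (a, j.1)) k) / v (a, b)
    have ex : ∀ i, MvPolynomial.eval w (x i) = v (i, b) / v (a, b) := fun i => by
      by_cases hi : i = a
      · subst hi
        simp [x, hvs]
      · simp [x, hi, w]
    have ey' : ∀ j, MvPolynomial.eval w (y' j) =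
        v (a, j) / v (a, b) - if j = a then v (a, a) / v (a, b) else 0 := fun j => by
      by_cases hb : j = b
      · subst hb
        simp [y', hvs, hab.symm]
      · by_cases ha : j = a
        · subst ha
          simp [y', hb]
        · simp [y', hb, ha, w]
    have esum : ∑ i, MvPolynomial.eval w (x i) * MvPolynomial.eval w (y' i) =
        - (v (a, a) / v (a, b)) := by
      have h1 : ∀ i, MvPolynomial.eval w (x i) * MvPolynomial.eval w (y' i) =
          v (i, i) / v (a, b) - if i = a then v (a, a) / v (a, b) else 0 := fun i => by
        rw [ex, ey', mul_sub]
        congr 1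
        · have := hm i b a i
          field_simp
          linear_combination this
        · split_ifs with h
          · subst h
            rw [div_self hvs, one_mul]
          · rw [mul_zero]
      rw [Finset.sum_congr rfl fun i _ => h1 i, Finset.sum_sub_distrib, ← Finset.sum_div, htr]
      simp
    have ey : MvPolynomial.eval w (y j) = v (a, j) / v (a, b) := by
      simp only [y, map_sub, ey']
      split_ifs with h
      · subst h
        rw [map_sum]
        simp only [map_mul, esum]
        ring
      · simp
    rw [map_mul, ex, ey]
    have := hm i b a j
    field_simp
    linear_combination -this

theorem hasAffineCharts_traceIdeal (hn : 2 ≤ n) :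
    HasAffineCharts (complexZeroLocus (traceIdeal n)) (n * n - 2) := by
  intro P hP
  obtain ⟨s, hs⟩ : ∃ s, P.rep s ≠ 0 := Function.ne_iff.1 P.rep_nonzero
  -- The trace equation is solved for the diagonal entry `(c, c)`, which must differ from the
  -- coordinate `s` normalized to `1`.
  obtain ⟨c, hc⟩ : ∃ c : Fin n, (c, c) ≠ s := by
    by_contra! h
    have := (h ⟨0, by omega⟩).trans (h ⟨1, by omega⟩).symm
    simp at this
  let τ : Type := {p : Fin n × Fin n // p ≠ s ∧ p ≠ (c, c)}
  let ψ : Fin n × Fin n → MvPolynomial τ ℂ := fun p =>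
    if hps : p = s then 1 else if hpc : p = (c, c) then 0 else MvPolynomial.X ⟨p, hps, hpc⟩
  refine ⟨τ, inferInstance, s, Subtype.val,
    fun p => ψ p - if p = (c, c) then ∑ i, ψ (i, i) else 0, ?_, ⟨?_, ?_, ?_, ?_⟩, hs⟩
  · rw [Fintype.card_subtype]
    have : (Finset.univ.filter fun p : Fin n × Fin n => p ≠ s ∧ p ≠ (c, c)) = {s, (c, c)}ᶜ := by
      ext p; simp
    rw [this, Finset.card_compl, Finset.card_pair hc.symm, Fintype.card_prod, Fintype.card_fin]
  · simp [ψ, hc.symm]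
  · rintro ⟨p, hps, hpc⟩
    simp [ψ, hps, hpc]
  · intro u
    rw [polyPoint, mk_mem_complexZeroLocus_traceIdeal, ← map_sum]
    simp [Finset.sum_sub_distrib]
  · intro v hv hvV hvs p
    rw [mk_mem_complexZeroLocus_traceIdeal] at hvV
    set w : τ → ℂ := fun k => v k / v s
    have eψ : ∀ p, MvPolynomial.eval w (ψ p) =
        v p / v s - if p = (c, c) then v (c, c) / v s else 0 := fun p => by
      by_cases hps : p = s
      · subst hps
        simp [ψ, hvs, hc.symm]
      · by_cases hpc : p = (c, c)
        · subst hpc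
          simp [ψ, hps]
        · simp [ψ, hps, hpc, w]
    have esum : ∑ i, MvPolynomial.eval w (ψ (i, i)) = - (v (c, c) / v s) := by
      simp only [eψ, Finset.sum_sub_distrib, ← Finset.sum_div, hvV]
      simp
    rw [map_sub, eψ]
    split_ifs with h
    · subst h
      rw [map_sum, esum]
      field_simp
      ring
    · rw [map_zero]
      field_simp
      ring

theorem complexZeroLocus_tracelessRankOneIdeal_subset :
    complexZeroLocus (tracelessRankOneIdeal n) ⊆ complexZeroLocus (traceIdeal n) := by
  intro P hP
  rw [← P.mk_rep] at hP ⊢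
  exact mk_mem_complexZeroLocus_traceIdeal.2 (mk_mem_complexZeroLocus_tracelessRankOneIdeal.1 hP).2

theorem complexZeroLocus_tracelessRankOneIdeal_nonempty (hn : 2 ≤ n) :
    (complexZeroLocus (tracelessRankOneIdeal n)).Nonempty := by
  have h01 : (⟨0, by omega⟩ : Fin n) ≠ ⟨1, by omega⟩ := by simp
  refine ⟨_, mk_outer_mem (x := Pi.single ⟨0, by omega⟩ 1) (y := Pi.single ⟨1, by omega⟩ 1)
    ?_ fun h => ?_⟩
  · refine Finset.sum_eq_zero fun i _ => ?_
    by_cases h : i = ⟨0, by omega⟩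
    · rw [h, Pi.single_eq_of_ne h01, mul_zero]
    · rw [Pi.single_eq_of_ne h, zero_mul]
  · simpa using congrFun h (⟨0, by omega⟩, ⟨1, by omega⟩)

/-- The matrices `e_i e_jᵀ` with `i ≠ j` kill the off-diagonal coefficients of the form, and `(e_i +
e_j)(e_i - e_j)ᵀ` makes the diagonal ones equal. What remains is a multiple of the trace. -/
theorem isNondegenerateIn_tracelessRankOneIdeal :
    IsNondegenerateIn (complexZeroLocus (tracelessRankOneIdeal n))
      (complexZeroLocus (traceIdeal n)) := by
  classical
  refine ⟨complexZeroLocus_tracelessRankOneIdeal_subset, fun l hl hV => hl fun P hP => ?_⟩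
  set L : Fin n → Fin n → ℂ := fun i j => l (Pi.single (i, j) 1) with hL
  have hl' : ∀ v, l v = ∑ i, ∑ j, v (i, j) * L i j := fun v => by
    rw [LinearMap.pi_apply_eq_sum_univ l v, Fintype.sum_prod_type]
    refine Finset.sum_congr rfl fun i _ => Finset.sum_congr rfl fun j _ => ?_
    rw [smul_eq_mul, hL]
    congr 2
    funext p
    simp [Pi.single_apply, eq_comm]
  have hout : ∀ x y : Fin n → ℂ, ∑ i, x i * y i = 0 → ∑ i, ∑ j, x i * y j * L i j = 0 := by
    intro x y hxy
    have hle : l (fun p : Fin n × Fin n => x p.1 * y p.2) = 0 := by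
      by_cases hv : (fun p : Fin n × Fin n => x p.1 * y p.2) = 0
      · rw [hv, map_zero]
      obtain ⟨a, ha⟩ := Projectivization.exists_smul_eq_mk_rep ℂ _ hv
      have ha' : (a : ℂ) • (fun p : Fin n × Fin n => x p.1 * y p.2) =
        (Projectivization.mk ℂ _ hv).rep := ha
      have h0 := hV _ (mk_outer_mem hxy hv)
      rw [← ha', map_smul, smul_eq_mul] at h0
      exact (mul_eq_zero.1 h0).resolve_left a.ne_zero
    rw [hl'] at hle
    exact hle
  have hoff : ∀ i j, i ≠ j → L i j = 0 := fun i j hij => by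
    simpa [Pi.single_apply, hij.symm] using hout (Pi.single i 1) (Pi.single j 1)
      (by simp [Pi.single_apply, Ne.symm hij])
  have hdiag : ∀ i j, L i i = L j j := fun i j => by
    by_cases hij : i = j
    · rw [hij]
    have := hout (Pi.single i 1 + Pi.single j 1) (Pi.single i 1 - Pi.single j 1)
      (by simp [mul_sub, Pi.single_apply, hij, Ne.symm hij])
    simp only [Pi.add_apply, Pi.sub_apply, add_mul, mul_sub, sub_mul, Finset.sum_add_distrib,
      Finset.sum_sub_distrib, Pi.single_apply, ite_mul, mul_ite, one_mul, zero_mul, mul_one,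
      mul_zero, Finset.sum_ite_eq', Finset.mem_univ, if_true,
      hoff i j hij, hoff j i (Ne.symm hij)] at this
    linear_combination this
  rw [← P.mk_rep, mk_mem_complexZeroLocus_traceIdeal] at hP
  rw [hl']
  have : ∀ i, ∑ j, P.rep (i, j) * L i j = P.rep (i, i) * L i i := fun i =>
    Finset.sum_eq_single i (fun j _ hj => by rw [hoff i j hj.symm, mul_zero]) (by simp)
  simp only [this]
  rcases isEmpty_or_nonempty (Fin n) with h | ⟨⟨i₀⟩⟩
  · simp
  · simp only [fun i => hdiag i i₀, ← Finset.sum_mul, hP, zero_mul]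

end TracelessRankOne

end

noncomputable section

/-! ### The Hilbert function via bihomogeneous polynomials -/

section HilbertFunction

open MvPolynomial

theorem Submodule.finrank_map_add_finrank_inf_ker {K M N : Type*} [Field K] [AddCommGroup M]
    [Module K M] [AddCommGroup N] [Module K N] (W : Submodule K M) [FiniteDimensional K W]
    (f : M →ₗ[K] N) :
    Module.finrank K (W.map f) + Module.finrank K (W ⊓ LinearMap.ker f : Submodule K M) =
      Module.finrank K W := by
  rw [← LinearMap.finrank_range_add_finrank_ker (f.domRestrict W), LinearMap.range_domRestrict,
    LinearMap.ker_domRestrict, ← Submodule.map_comap_subtype, Submodule.finrank_map_subtype_eq]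

theorem MvPolynomial.IsWeightedHomogeneous.weightedHomogeneousComponent_mul {σ M : Type*}
    [AddCancelCommMonoid M] {w : σ → M} {a : M} {q : MvPolynomial σ ℂ}
    (hq : q.IsWeightedHomogeneous w a) (m : M) (g : MvPolynomial σ ℂ) :
    weightedHomogeneousComponent w (a + m) (q * g) = q * weightedHomogeneousComponent w m g := by
  classical
  induction g using MvPolynomial.induction_on' with
  | monomial d c =>
    have hd := isWeightedHomogeneous_monomial w d c rfl
    rw [weightedHomogeneousComponent_of_mem hd, weightedHomogeneousComponent_of_mem (hq.mul hd)]
    simp only [add_right_inj, mul_ite, mul_zero]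
  | add p r hp hr => rw [mul_add, map_add, hp, hr, map_add, mul_add]

theorem MvPolynomial.weightedHomogeneousSubmodule_eq_restrictSupport {σ M : Type*}
    [AddCommMonoid M] (w : σ → M) (m : M) :
    weightedHomogeneousSubmodule ℂ w m = restrictSupport ℂ {d | Finsupp.weight w d = m} :=
  weightedHomogeneousSubmodule_eq_finsupp_supported ℂ w m

variable {n : ℕ}

/-- The bidegree on polynomials in two sets of `n` variables. -/
def bidegreeWeight (n : ℕ) : Fin n ⊕ Fin n → ℕ × ℕ := Sum.elim (fun _ => (1, 0)) fun _ => (0, 1)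

theorem weight_bidegreeWeight (m : Fin n ⊕ Fin n →₀ ℕ) :
    Finsupp.weight (bidegreeWeight n) m = (∑ i, m (Sum.inl i), ∑ j, m (Sum.inr j)) := by
  rw [Finsupp.weight_apply, Finsupp.sum_fintype _ _ (by simp), Fintype.sum_sum_type]
  ext <;> simp [bidegreeWeight, Prod.fst_sum, Prod.snd_sum]

/-- The bihomogeneous polynomials of bidegree `(d, e)`. -/
abbrev bihomogeneousSubmodule (n d e : ℕ) : Submodule ℂ (MvPolynomial (Fin n ⊕ Fin n) ℂ) :=
  weightedHomogeneousSubmodule ℂ (bidegreeWeight n) (d, e)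

/-- The exponents of bidegree `(d, e)` are the pairs of exponents of degrees `d` and `e`. -/
def bidegreeEquiv (n d e : ℕ) :
    {m : Fin n ⊕ Fin n →₀ ℕ | Finsupp.weight (bidegreeWeight n) m = (d, e)} ≃
      (Finset.finsuppAntidiag (Finset.univ : Finset (Fin n)) d) ×
        (Finset.finsuppAntidiag (Finset.univ : Finset (Fin n)) e) where
  toFun m := ⟨⟨(Finsupp.sumFinsuppEquivProdFinsupp m.1).1, by
      have h := m.2
      rw [Set.mem_ofPred_eq, weight_bidegreeWeight, Prod.mk.injEq] at h
      rw [Finset.mem_finsuppAntidiag]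
      exact ⟨h.1, Finset.subset_univ _⟩⟩,
    ⟨(Finsupp.sumFinsuppEquivProdFinsupp m.1).2, by
      have h := m.2
      rw [Set.mem_ofPred_eq, weight_bidegreeWeight, Prod.mk.injEq] at h
      rw [Finset.mem_finsuppAntidiag]
      exact ⟨h.2, Finset.subset_univ _⟩⟩⟩
  invFun p := ⟨Finsupp.sumFinsuppEquivProdFinsupp.symm (p.1.1, p.2.1), by
    have h1 := p.1.2
    have h2 := p.2.2
    rw [Finset.mem_finsuppAntidiag] at h1 h2
    rw [Set.mem_ofPred_eq, weight_bidegreeWeight]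
    simp [h1.1, h2.1]⟩
  left_inv m := by simp
  right_inv p := by simp

theorem finite_bidegree (n d e : ℕ) :
    Finite {m : Fin n ⊕ Fin n →₀ ℕ | Finsupp.weight (bidegreeWeight n) m = (d, e)} :=
  Finite.of_equiv _ (bidegreeEquiv n d e).symm

instance finiteDimensional_bihomogeneousSubmodule (n d e : ℕ) :
    FiniteDimensional ℂ (bihomogeneousSubmodule n d e) := by
  have := finite_bidegree n d e
  rw [bihomogeneousSubmodule, weightedHomogeneousSubmodule_eq_restrictSupport]
  exact Module.Finite.of_basis (basisRestrictSupport ℂ _)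

theorem finrank_bihomogeneousSubmodule (n d e : ℕ) :
    Module.finrank ℂ (bihomogeneousSubmodule n d e) =
      (n + d - 1).choose d * (n + e - 1).choose e := by
  rw [bihomogeneousSubmodule, weightedHomogeneousSubmodule_eq_restrictSupport,
    Module.finrank_eq_nat_card_basis (basisRestrictSupport ℂ _),
    Nat.card_congr (bidegreeEquiv n d e), Nat.card_prod, Nat.card_eq_fintype_card,
    Nat.card_eq_fintype_card, Fintype.card_coe, Fintype.card_coe,
    Finset.card_finsuppAntidiag_nat_eq_choose, Finset.card_finsuppAntidiag_nat_eq_choose,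
    Finset.card_univ, Fintype.card_fin]

/-- The bilinear form `∑ x_i y_i`. -/
def pairingPoly (n : ℕ) : MvPolynomial (Fin n ⊕ Fin n) ℂ := ∑ i, X (Sum.inl i) * X (Sum.inr i)

theorem isWeightedHomogeneous_pairingPoly :
    (pairingPoly n).IsWeightedHomogeneous (bidegreeWeight n) (1, 1) :=
  IsWeightedHomogeneous.sum _ _ _ fun i _ => by
    simpa [bidegreeWeight] using (isWeightedHomogeneous_X ℂ (bidegreeWeight n) (Sum.inl i)).mul
      (isWeightedHomogeneous_X ℂ (bidegreeWeight n) (Sum.inr i))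

theorem pairingPoly_ne_zero (hn : 1 ≤ n) : pairingPoly n ≠ 0 := by
  intro h
  have := congrArg (eval (Sum.elim (Pi.single ⟨0, hn⟩ 1) (Pi.single ⟨0, hn⟩ 1))) h
  simp [pairingPoly, Pi.single_apply] at this

/-- As `q` is itself bihomogeneous, the cofactor of a bihomogeneous multiple of `q` can be replaced
by its component of bidegree `(d, e)`. -/
theorem bihomogeneousSubmodule_inf_span (d e : ℕ) :
    bihomogeneousSubmodule n (d + 1) (e + 1) ⊓
        LinearMap.ker (Ideal.Quotient.mkₐ ℂ (Ideal.span {pairingPoly n})).toLinearMap =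
      (bihomogeneousSubmodule n d e).map (LinearMap.mulLeft ℂ (pairingPoly n)) := by
  have hmem : ∀ f, f ∈ LinearMap.ker
      (Ideal.Quotient.mkₐ ℂ (Ideal.span {pairingPoly n})).toLinearMap ↔ pairingPoly n ∣ f :=
    fun f => by
      rw [LinearMap.mem_ker, AlgHom.toLinearMap_apply, Ideal.Quotient.mkₐ_eq_mk,
        Ideal.Quotient.eq_zero_iff_mem, Ideal.mem_span_singleton]
  have hde : ((1, 1) : ℕ × ℕ) + (d, e) = (d + 1, e + 1) := by
    simp [add_comm]
  ext f
  rw [Submodule.mem_inf, hmem, Submodule.mem_map]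
  constructor
  · rintro ⟨hf, g, rfl⟩
    refine ⟨weightedHomogeneousComponent (bidegreeWeight n) (d, e) g,
      weightedHomogeneousComponent_isWeightedHomogeneous _ _, ?_⟩
    rw [LinearMap.mulLeft_apply,
      ← isWeightedHomogeneous_pairingPoly.weightedHomogeneousComponent_mul, hde]
    exact weightedHomogeneousComponent_eq_self hf
  · rintro ⟨g, hg, rfl⟩
    refine ⟨?_, Dvd.intro _ rfl⟩
    rw [LinearMap.mulLeft_apply, mem_weightedHomogeneousSubmodule, ← hde]
    exact isWeightedHomogeneous_pairingPoly.mul hg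

/-- The parametrization `z_ij ↦ x_i y_j` of the matrices of rank at most one. -/
def outerHom (n : ℕ) : MvPolynomial (Fin n × Fin n) ℂ →ₐ[ℂ] MvPolynomial (Fin n ⊕ Fin n) ℂ :=
  aeval fun p => X (Sum.inl p.1) * X (Sum.inr p.2)

theorem aeval_outerHom {A : Type*} [CommRing A] [Algebra ℂ A] (z : Fin n ⊕ Fin n → A)
    (f : MvPolynomial (Fin n × Fin n) ℂ) :
    aeval z (outerHom n f) = aeval (fun p => z (Sum.inl p.1) * z (Sum.inr p.2)) f := by
  rw [outerHom, ← AlgHom.comp_apply, comp_aeval]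
  simp

theorem outerHom_mem {d : ℕ} {f : MvPolynomial (Fin n × Fin n) ℂ} (hf : f.IsHomogeneous d) :
    outerHom n f ∈ bihomogeneousSubmodule n d d := by
  rw [f.as_sum, map_sum]
  refine Submodule.sum_mem _ fun m hm => ?_
  rw [outerHom, aeval_monomial, algebraMap_eq, ← smul_eq_C_mul]
  refine Submodule.smul_mem _ _ ?_
  have hd : ∑ p ∈ m.support, m p = d := by
    have := hf (mem_support_iff.1 hm)
    rwa [Finsupp.weight_apply, Finsupp.sum, Finset.sum_congr rfl fun i _ => by
      rw [Pi.one_apply, smul_eq_mul, mul_one]] at this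
  rw [mem_weightedHomogeneousSubmodule, Finsupp.prod]
  have key : ∀ p ∈ m.support,
      ((X (Sum.inl p.1) * X (Sum.inr p.2) : MvPolynomial (Fin n ⊕ Fin n) ℂ) ^ m p
        ).IsWeightedHomogeneous (bidegreeWeight n) (m p • ((1, 1) : ℕ × ℕ)) := fun p _ => by
    refine IsWeightedHomogeneous.pow ?_ _
    simpa [bidegreeWeight] using (isWeightedHomogeneous_X ℂ (bidegreeWeight n) (Sum.inl p.1)).mul
      (isWeightedHomogeneous_X ℂ (bidegreeWeight n) (Sum.inr p.2))
  have := IsWeightedHomogeneous.prod m.support _ _ key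
  rw [← Finset.sum_smul, hd] at this
  simpa using this

/-- Equal degrees in `x` and `y` allow one `x_i` and one `y_j` to be split off together as the image
of `z_ij`. -/
theorem exists_outerHom_eq_monomial (d : ℕ) (m : Fin n ⊕ Fin n →₀ ℕ)
    (hm : Finsupp.weight (bidegreeWeight n) m = (d, d)) :
    ∃ f : MvPolynomial (Fin n × Fin n) ℂ, f.IsHomogeneous d ∧ outerHom n f = monomial m 1 := by
  induction d generalizing m with
  | zero =>
    rw [weight_bidegreeWeight, Prod.mk.injEq, Finset.sum_eq_zero_iff, Finset.sum_eq_zero_iff] at hm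
    have : m = 0 := by
      ext (i | i)
      · exact hm.1 i (Finset.mem_univ i)
      · exact hm.2 i (Finset.mem_univ i)
    exact ⟨1, isHomogeneous_one _ _, by rw [map_one, this]; rfl⟩
  | succ d ih =>
    have hm' := hm
    rw [weight_bidegreeWeight, Prod.mk.injEq] at hm'
    obtain ⟨i, -, hi⟩ := Finset.exists_ne_zero_of_sum_ne_zero
      (by rw [hm'.1]; omega : ∑ i, m (Sum.inl i) ≠ 0)
    obtain ⟨j, -, hj⟩ := Finset.exists_ne_zero_of_sum_ne_zero
      (by rw [hm'.2]; omega : ∑ i, m (Sum.inr i) ≠ 0)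
    have hle : Finsupp.single (Sum.inl i) 1 + Finsupp.single (Sum.inr j) 1 ≤ m := by
      rintro (k | k)
      · by_cases hk : i = k
        · subst hk
          simpa using Nat.one_le_iff_ne_zero.2 hi
        · simp [hk]
      · by_cases hk : j = k
        · subst hk
          simpa using Nat.one_le_iff_ne_zero.2 hj
        · simp [hk]
    obtain ⟨m', rfl⟩ := exists_add_of_le hle
    obtain ⟨f, hf, hfm⟩ := ih m' (by
      simp only [map_add, Finsupp.weight_single, bidegreeWeight, Sum.elim_inl, Sum.elim_inr,
        one_smul, Prod.ext_iff, Prod.fst_add, Prod.snd_add] at hm ⊢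
      omega)
    refine ⟨f * X (i, j), hf.mul (isHomogeneous_X _ _), ?_⟩
    rw [map_mul, hfm, outerHom, aeval_X, X, X, monomial_mul, monomial_mul]
    simp [add_comm]

theorem map_outerHom_homogeneousSubmodule (n d : ℕ) :
    (homogeneousSubmodule (Fin n × Fin n) ℂ d).map (outerHom n).toLinearMap =
      bihomogeneousSubmodule n d d := by
  apply le_antisymm
  · rintro _ ⟨f, hf, rfl⟩
    exact outerHom_mem hf
  · intro g hg
    rw [g.as_sum]
    refine Submodule.sum_mem _ fun m hm => ?_
    obtain ⟨f, hf, hfm⟩ := exists_outerHom_eq_monomial d m (hg (mem_support_iff.1 hm))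
    refine ⟨C (g.coeff m) * f, ?_, ?_⟩
    · simpa using (isHomogeneous_C _ (g.coeff m)).mul hf
    · rw [AlgHom.toLinearMap_apply, map_mul, hfm]
      simp [outerHom, C_mul_monomial]

theorem aeval_smul_inl {A : Type*} [CommRing A] [Algebra ℂ A] {d e : ℕ}
    {g : MvPolynomial (Fin n ⊕ Fin n) ℂ} (hg : g ∈ bihomogeneousSubmodule n d e) (c : A)
    (x y : Fin n → A) :
    aeval (Sum.elim (fun i => c * x i) y) g = c ^ d * aeval (Sum.elim x y) g := by
  rw [aeval_def, aeval_def, eval₂_eq', eval₂_eq', Finset.mul_sum]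
  refine Finset.sum_congr rfl fun m hm => ?_
  have hd := hg (mem_support_iff.1 hm)
  rw [weight_bidegreeWeight, Prod.mk.injEq] at hd
  rw [Fintype.prod_sum_type, Fintype.prod_sum_type]
  simp only [Sum.elim_inl, Sum.elim_inr, mul_pow, Finset.prod_mul_distrib,
    Finset.prod_pow_eq_pow_sum, hd.1]
  ring

/-- Substituting a generic point of the hypersurface replaces the Nullstellensatz: it shows that `q`
divides `y_0 ^ d g`, and the power of `y_0` can be cancelled because `y_0` is a prime not dividing
`q`. -/
theorem pairingPoly_dvd_of_forall_eval_eq_zero (hn : 2 ≤ n) {d e : ℕ}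
    {g : MvPolynomial (Fin n ⊕ Fin n) ℂ} (hg : g ∈ bihomogeneousSubmodule n d e)
    (h : ∀ x y : Fin n → ℂ, ∑ i, x i * y i = 0 → eval (Sum.elim x y) g = 0) :
    pairingPoly n ∣ g := by
  set i₀ : Fin n := ⟨0, by omega⟩ with hi₀
  set i₁ : Fin n := ⟨1, by omega⟩ with hi₁
  have h01 : i₀ ≠ i₁ := by simp [hi₀, hi₁]
  set Y : MvPolynomial (Fin n ⊕ Fin n) ℂ := X (Sum.inr i₀) with hY
  -- a generic point of the hypersurface `∑ x_i y_i = 0`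
  set θ : Fin n → MvPolynomial (Fin n ⊕ Fin n) ℂ := fun i =>
    Y * X (Sum.inl i) - if i = i₀ then pairingPoly n else 0 with hθ
  have hθ0 : aeval (Sum.elim θ fun j => X (Sum.inr j)) g = 0 := by
    refine MvPolynomial.funext fun u => ?_
    rw [map_zero, ← coe_aeval_eq_eval, RingHom.coe_coe, ← AlgHom.comp_apply, comp_aeval,
      ← RingHom.coe_coe, coe_aeval_eq_eval]
    convert h (fun i => eval u (θ i)) (fun j => u (Sum.inr j)) ?_ using 2
    · congr 1
      funext k
      rcases k with k | k <;> simp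
    · have e : ∀ i, eval u (θ i) = u (Sum.inr i₀) * u (Sum.inl i) -
          if i = i₀ then ∑ k, u (Sum.inl k) * u (Sum.inr k) else 0 := fun i => by
        simp only [hθ, hY]
        split_ifs <;> simp [pairingPoly]
      simp only [e, sub_mul, Finset.sum_sub_distrib, ite_mul, zero_mul, Finset.sum_ite_eq',
        Finset.mem_univ, if_true, Finset.sum_mul, sub_eq_zero]
      exact Finset.sum_congr rfl fun i _ => by ring
  -- Modulo `q` the point `θ` is `y_0 x`, so homogeneity in `x` turns `g(θ, y) = 0` into `y_0 ^ d g
  -- = 0`.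
  have hYg : pairingPoly n ∣ Y ^ d * g := by
    rw [← Ideal.mem_span_singleton, ← Ideal.Quotient.eq_zero_iff_mem,
      ← Ideal.Quotient.mkₐ_eq_mk ℂ]
    set π := Ideal.Quotient.mkₐ ℂ (Ideal.span {pairingPoly n})
    have hq : π (pairingPoly n) = 0 := by
      rw [Ideal.Quotient.mkₐ_eq_mk, Ideal.Quotient.eq_zero_iff_mem]
      exact Ideal.mem_span_singleton_self _
    have h1 := aeval_smul_inl hg (π Y) (fun i => π (X (Sum.inl i))) (fun j => π (X (Sum.inr j)))
    have h2 : aeval (Sum.elim (fun i => π (X (Sum.inl i))) fun j => π (X (Sum.inr j))) g =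
        π g := by
      conv_rhs => rw [← aeval_X_left_apply g, ← AlgHom.comp_apply, comp_aeval]
      congr 2
      funext k
      rcases k with k | k <;> rfl
    have h3 : aeval (Sum.elim (fun i => π Y * π (X (Sum.inl i))) fun j => π (X (Sum.inr j))) g =
        π (aeval (Sum.elim θ fun j => X (Sum.inr j)) g) := by
      rw [← AlgHom.comp_apply, comp_aeval]
      congr 2
      funext k
      rcases k with k | k
      · simp only [Sum.elim_inl, hθ, map_sub, map_mul]
        split_ifs <;> simp [hq]
      · rfl
    rw [map_mul, map_pow, ← h2, ← h1, h3, hθ0, map_zero]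
  obtain ⟨k, hk⟩ := hYg
  have hYprime : Prime Y := X_prime
  -- At `x = y = e_1` the form `q` is `1` while `y_0` is `0`; this needs a second index.
  have hYq : ¬ Y ∣ pairingPoly n := by
    rintro ⟨r, hr⟩
    have := congrArg (eval (Sum.elim (Pi.single i₁ 1) (Pi.single i₁ 1))) hr
    simp [pairingPoly, hY, Pi.single_apply, h01] at this
  obtain ⟨k', rfl⟩ := hYprime.pow_dvd_of_dvd_mul_left d hYq (Dvd.intro _ hk)
  refine ⟨k', mul_left_cancel₀ (pow_ne_zero d hYprime.ne_zero) ?_⟩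
  rw [hk]
  ring

/-- Points of the variety are the nonzero `x yᵀ` with `q(x, y) = 0`. The condition `d ≠ 0` covers
pairs with `x yᵀ = 0`, where only a form of positive degree must vanish. -/
theorem mem_vanishingIdealProj_iff_pairingPoly_dvd (hn : 2 ≤ n) {d : ℕ} (hd : d ≠ 0)
    {f : MvPolynomial (Fin n × Fin n) ℂ} (hf : f.IsHomogeneous d) :
    f ∈ vanishingIdealProj (complexZeroLocus (tracelessRankOneIdeal n)) ↔
      pairingPoly n ∣ outerHom n f := by
  have heval : ∀ x y : Fin n → ℂ, eval (Sum.elim x y) (outerHom n f) =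
      eval (fun p => x p.1 * y p.2) f := fun x y => by
    rw [← coe_aeval_eq_eval, RingHom.coe_coe, aeval_outerHom]
    rfl
  constructor
  · refine fun hfV => pairingPoly_dvd_of_forall_eval_eq_zero hn (outerHom_mem hf) fun x y hxy => ?_
    rw [heval]
    by_cases hv : (fun p : Fin n × Fin n => x p.1 * y p.2) = 0
    · rw [hv, ← zero_smul ℂ (0 : Fin n × Fin n → ℂ), hf.eval_smul, zero_pow hd, zero_mul]
    · exact hfV _ hv (mk_outer_mem hxy hv)
  · rintro ⟨k, hk⟩ v hv hvV
    rw [mk_mem_complexZeroLocus_tracelessRankOneIdeal] at hvV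
    obtain ⟨hm, htr⟩ := hvV
    obtain ⟨⟨a, b⟩, hab⟩ : ∃ s, v s ≠ 0 := Function.ne_iff.1 hv
    -- A rank-one matrix is its column `b` times its row `a`, divided by the nonzero entry `(a, b)`.
    have hout : v = fun p : Fin n × Fin n => v (p.1, b) * (v (a, p.2) / v (a, b)) := by
      funext ⟨i, j⟩
      have := hm i j a b
      field_simp
      linear_combination this
    rw [hout, ← heval (fun i => v (i, b)) (fun j => v (a, j) / v (a, b)), hk, map_mul]
    have : eval (Sum.elim (fun i => v (i, b)) (fun j => v (a, j) / v (a, b))) (pairingPoly n) =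
        ∑ i, v (i, i) := by
      simp only [pairingPoly, map_sum, map_mul, eval_X, Sum.elim_inl, Sum.elim_inr]
      exact Finset.sum_congr rfl fun i _ => (congrFun hout (i, i)).symm
    rw [this, htr, zero_mul]

/-- On forms of degree `d + 1`, reduction modulo the vanishing ideal and substitution followed by
reduction modulo `q` have the same kernel, hence images of equal dimension. Rank-nullity in bidegree
`(d + 1, d + 1)` then applies, the kernel being `q` times bidegree `(d, d)`. -/
theorem hilbertFunction_add_eq (hn : 2 ≤ n) (d : ℕ) :
    hilbertFunction (complexZeroLocus (tracelessRankOneIdeal n)) (d + 1) +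
      (n + d - 1).choose d ^ 2 = (n + d).choose (d + 1) ^ 2 := by
  set S := homogeneousSubmodule (Fin n × Fin n) ℂ (d + 1) with hS
  have : FiniteDimensional ℂ S := by
    change FiniteDimensional ℂ (weightedHomogeneousSubmodule ℂ (1 : Fin n × Fin n → ℕ) (d + 1))
    rw [weightedHomogeneousSubmodule_eq_restrictSupport]
    have := (Finsupp.finite_of_nat_weight_eq (1 : Fin n × Fin n → ℕ) (by simp)
      (d + 1)).to_subtype
    exact Module.Finite.of_basis (basisRestrictSupport ℂ _)
  set α := (Ideal.Quotient.mkₐ ℂ (vanishingIdealProj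
    (complexZeroLocus (tracelessRankOneIdeal n)))).toLinearMap with hα
  set π := (Ideal.Quotient.mkₐ ℂ (Ideal.span {pairingPoly n})).toLinearMap with hπ
  set β := π.comp (outerHom n).toLinearMap with hβ
  have hker : S ⊓ LinearMap.ker α = S ⊓ LinearMap.ker β := by
    ext f
    refine and_congr_right fun hf => ?_
    change α f = 0 ↔ β f = 0
    rw [hβ, LinearMap.comp_apply, hα, hπ, AlgHom.toLinearMap_apply, AlgHom.toLinearMap_apply,
      AlgHom.toLinearMap_apply, Ideal.Quotient.mkₐ_eq_mk, Ideal.Quotient.mkₐ_eq_mk,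
      Ideal.Quotient.eq_zero_iff_mem, Ideal.Quotient.eq_zero_iff_mem, Ideal.mem_span_singleton]
    exact mem_vanishingIdealProj_iff_pairingPoly_dvd hn d.succ_ne_zero hf
  have hrank : Module.finrank ℂ (S.map α) = Module.finrank ℂ (S.map β) := by
    have h1 := S.finrank_map_add_finrank_inf_ker α
    have h2 := S.finrank_map_add_finrank_inf_ker β
    rw [hker] at h1
    omega
  have hW := (bihomogeneousSubmodule n (d + 1) (d + 1)).finrank_map_add_finrank_inf_ker π
  have hinj : Function.Injective (LinearMap.mulLeft ℂ (pairingPoly n)) :=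
    mul_right_injective₀ (pairingPoly_ne_zero (by omega))
  rw [hπ, bihomogeneousSubmodule_inf_span,
    ← (Submodule.equivMapOfInjective _ hinj (bihomogeneousSubmodule n d d)).finrank_eq,
    finrank_bihomogeneousSubmodule, finrank_bihomogeneousSubmodule,
    ← map_outerHom_homogeneousSubmodule, ← Submodule.map_comp, ← hπ, ← hβ, ← hS, ← hrank] at hW
  rw [hilbertFunction, ← hS, ← hα, sq, sq, hW]
  rfl

end HilbertFunction

end

noncomputable section

/-! ### The Hilbert polynomial and the degree -/

section Degree

open Polynomial

/-- `(X + 1) ⋯ (X + m)`. -/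
def shiftedRising (m : ℕ) : ℚ[X] := (ascPochhammer ℚ m).comp (X + 1)

theorem shiftedRising_eval (m d : ℕ) :
    (shiftedRising m).eval (d : ℚ) = ((d + 1).ascFactorial m : ℕ) := by
  rw [shiftedRising, eval_comp, ← ascPochhammer_nat_eq_ascFactorial, ascPochhammer_eval_cast]
  simp

theorem shiftedRising_monic (m : ℕ) : (shiftedRising m).Monic := by
  rw [shiftedRising, ← C_1]
  exact (monic_ascPochhammer ℚ m).comp_X_add_C 1

theorem shiftedRising_natDegree (m : ℕ) : (shiftedRising m).natDegree = m := by
  rw [shiftedRising, ← C_1, natDegree_comp, natDegree_X_add_C, mul_one, ascPochhammer_natDegree]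

/-- The Hilbert polynomial of the variety of traceless rank one matrices of size `m + 2`. -/
def tracelessRankOneHilbertPoly (m : ℕ) : ℚ[X] :=
  C (2 * (m + 1) / ((m + 1).factorial : ℚ) ^ 2) *
    (shiftedRising m ^ 2 * (X + C ((m + 1 : ℚ) / 2)))

theorem tracelessRankOneHilbertPoly_monic_factor (m : ℕ) :
    (shiftedRising m ^ 2 * (X + C ((m + 1 : ℚ) / 2))).Monic :=
  ((shiftedRising_monic m).pow 2).mul (monic_X_add_C _)

theorem tracelessRankOneHilbertPoly_leadingCoeff (m : ℕ) :
    (tracelessRankOneHilbertPoly m).leadingCoeff =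
      2 * (m + 1) / ((m + 1).factorial : ℚ) ^ 2 := by
  rw [tracelessRankOneHilbertPoly, leadingCoeff_mul,
    (tracelessRankOneHilbertPoly_monic_factor m).leadingCoeff, leadingCoeff_C, mul_one]

theorem tracelessRankOneHilbertPoly_natDegree (m : ℕ) :
    (tracelessRankOneHilbertPoly m).natDegree = 2 * m + 1 := by
  rw [tracelessRankOneHilbertPoly, natDegree_C_mul (by positivity),
    ((shiftedRising_monic m).pow 2).natDegree_mul (monic_X_add_C _), natDegree_X_add_C,
    (shiftedRising_monic m).natDegree_pow, shiftedRising_natDegree]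

/-- Multiplied by `(m + 1)!`, both binomials contain `(d + 2) ⋯ (d + m + 1)`, with remaining factors
`d + m + 2` and `d + 1`. The difference of the squares of these is `2 (m + 1) ((d + 1) + (m + 1) /
2)`. -/
theorem tracelessRankOneHilbertPoly_eval (m d : ℕ) :
    (tracelessRankOneHilbertPoly m).eval ((d + 1 : ℕ) : ℚ) =
      ((m + 2 + d).choose (d + 1) : ℚ) ^ 2 - ((m + 2 + d - 1).choose d : ℚ) ^ 2 := by
  have h1 : ((m + 2 + d).choose (d + 1) : ℚ) * (m + 1).factorial =
      ((d + 2).ascFactorial m : ℕ) * (d + 1 + (m + 1)) := by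
    have := Nat.ascFactorial_eq_factorial_mul_choose (d + 1) (m + 1)
    rw [Nat.ascFactorial_succ] at this
    have hc : (d + 1 + (m + 1)).choose (m + 1) = (m + 2 + d).choose (d + 1) := by
      rw [show m + 2 + d = (m + 1) + (d + 1) by ring, add_comm (d + 1), Nat.choose_symm_add]
    rw [hc] at this
    have := congrArg (Nat.cast : ℕ → ℚ) this
    push_cast at this
    linear_combination -this
  have h2 : ((m + 2 + d - 1).choose d : ℚ) * (m + 1).factorial =
      ((d + 2).ascFactorial m : ℕ) * (d + 1) := by
    have := Nat.ascFactorial_eq_factorial_mul_choose d (m + 1)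
    rw [Nat.ascFactorial_succ, ← Nat.succ_ascFactorial] at this
    have hc : (d + (m + 1)).choose (m + 1) = (m + 2 + d - 1).choose d := by
      rw [show m + 2 + d - 1 = (m + 1) + d by omega, add_comm d, Nat.choose_symm_add]
    rw [hc] at this
    have := congrArg (Nat.cast : ℕ → ℚ) this
    push_cast at this
    linear_combination -this
  have hf : ((m + 1).factorial : ℚ) ≠ 0 := by positivity
  rw [← eq_div_iff hf] at h1 h2
  rw [h1, h2, tracelessRankOneHilbertPoly, eval_mul, eval_C, eval_mul, eval_pow,
    shiftedRising_eval, eval_add, eval_X, eval_C]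
  push_cast
  field_simp
  ring

theorem hasProjDegree_tracelessRankOneIdeal {n : ℕ} (hn : 2 ≤ n) :
    HasProjDegree (complexZeroLocus (tracelessRankOneIdeal n))
      ((2 * n - 2).choose (n - 1)) := by
  obtain ⟨m, rfl⟩ : ∃ m, n = m + 2 := ⟨n - 2, by omega⟩
  refine ⟨2 * (m + 2) - 3, tracelessRankOneHilbertPoly m,
    hasAffineCharts_tracelessRankOneIdeal.projDim_eq
      (complexZeroLocus_tracelessRankOneIdeal_nonempty hn), ⟨1, fun d hd => ?_⟩, ?_, ?_⟩
  · obtain ⟨d, rfl⟩ : ∃ e, d = e + 1 := ⟨d - 1, by omega⟩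
    rw [tracelessRankOneHilbertPoly_eval]
    have := congrArg (Nat.cast : ℕ → ℚ) (hilbertFunction_add_eq hn d)
    push_cast at this
    linear_combination -this
  · rw [tracelessRankOneHilbertPoly_natDegree]
    omega
  · rw [tracelessRankOneHilbertPoly_leadingCoeff, show 2 * (m + 2) - 3 = 2 * m + 1 by omega,
      show 2 * (m + 2) - 2 = (m + 1) + (m + 1) by omega, show m + 2 - 1 = m + 1 by omega]
    have h := Nat.add_choose_mul_factorial_mul_factorial (m + 1) (m + 1)
    rw [show m + 1 + (m + 1) = (2 * m + 1) + 1 by ring, Nat.factorial_succ (2 * m + 1)] at h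
    have h' := congrArg (Nat.cast : ℕ → ℚ) h
    push_cast at h'
    rw [show m + 1 + (m + 1) = (2 * m + 1) + 1 by ring, ← mul_div_assoc, div_eq_iff (by positivity)]
    -- The identity behind this is `(2m + 1)! * 2 (m + 1) = (2m + 2)!`.
    linear_combination -h'

end Degree

end

theorem mainTheorem11 (n : ℕ) (hn : 2 ≤ n) :
    IsSmoothProj (complexZeroLocus (tracelessRankOneIdeal n)) ∧
    IsNondegenerateIn (complexZeroLocus (tracelessRankOneIdeal n))
      (complexZeroLocus (traceIdeal n)) ∧
    projDim (complexZeroLocus (tracelessRankOneIdeal n)) = ((2 * n - 3 : ℕ) : WithBot ℕ∞) ∧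
    HasCodimIn (complexZeroLocus (tracelessRankOneIdeal n))
      (complexZeroLocus (traceIdeal n)) ((n - 1) ^ 2) ∧
    HasProjDegree (complexZeroLocus (tracelessRankOneIdeal n))
      ((2 * n - 2).choose (n - 1)) := by
  have hV := hasAffineCharts_tracelessRankOneIdeal.projDim_eq
    (complexZeroLocus_tracelessRankOneIdeal_nonempty hn)
  refine ⟨hasAffineCharts_tracelessRankOneIdeal.isSmoothProj,
    isNondegenerateIn_tracelessRankOneIdeal, hV,
    ⟨complexZeroLocus_tracelessRankOneIdeal_subset, _, _, hV,
      (hasAffineCharts_traceIdeal hn).projDim_eq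
        ((complexZeroLocus_tracelessRankOneIdeal_nonempty hn).mono
          complexZeroLocus_tracelessRankOneIdeal_subset), ?_⟩,
    hasProjDegree_tracelessRankOneIdeal hn⟩
  obtain ⟨m, rfl⟩ : ∃ m, n = m + 2 := ⟨n - 2, by omega⟩
  rw [show 2 * (m + 2) - 3 = 2 * m + 1 by omega, show m + 2 - 1 = m + 1 by omega]
  -- With `n = m + 2`, the codimension is `(n ^ 2 - 2) - (2n - 3) = (n - 1) ^ 2`.
  refine (Nat.sub_eq_of_eq_add ?_).symm
  ring
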